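/- **Setting.** A graph is a triple $(V,D,L)$ with $V$ a finite set of nodes, $D\subseteq V^2$ a symmetric set of edges and $L:V\to\mathbb{R}^n$ a labelling; $\mathrm{Neigh}(v)=\{u\mid (v,u)\in D\}$, and its degree is the least $d$ with $|\mathrm{Neigh}(v)|\le d$ for all $v$. A neural network (NN) is a feed-forward network with rational weights and biases and the activation $\max(0,x)$ in every layer. A node-classifier MPNN $N$ consists of NN $N_1,\dots,N_k$ and $N_r$ of matching dimensions; on a graph with labels in $\mathbb{R}^n$ and a node $v$ it computes $x^0_v=L(v)$, $x^i_v=N_i\bigl(x^{i-1}_v,\sum_{u\in\mathrm{Neigh}(v)}x^{i-1}_u\bigr)$ and $N(G,v)=N_r(x^k_v)$. A vector specification is a finite conjunction of linear inequalities $\sum_i c_i x_i\le b$ with $c_i,b\in\mathbb{Q}$. $\Phi_{\mathsf{bound}}$ is the set of all graph-node specifications $\varphi$ given by a number $d\in\mathbb{N}$ and finitely many pairs $(r_1,\psi_1),\dots,(r_s,\psi_s)$ of a radius $r_j\in\mathbb{N}$ and a vector specification $\psi_j$; $(G,v)\models\varphi$ means that $G$ has degree at most $d$ and that, for every $j$,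 the label of every node of distance at most $r_j$ from $v$ satisfies $\psi_j$. $\Psi_{\mathsf{class}}$ is the set of all output specifications $\bigvee_{i\in I}\bigwedge_{j\in I\setminus\{i\}}x_i>x_j$, where $I$ is a finite set of output dimensions. The adversarial robustness property $(N,\varphi,\psi)$ holds if $N(G,v)\models\psi$ for all $(G,v)\models\varphi$; $\mathrm{ARP}_{\mathsf{node}}(\Phi_{\mathsf{bound}},\Psi_{\mathsf{class}})$ is the set of all such triples with $N$ a node-classifier MPNN, $\varphi\in\Phi_{\mathsf{bound}}$ over the input dimension of $N$ and $\psi\in\Psi_{\mathsf{class}}$ over its output dimension. **Corollary 2.** $\mathrm{ARP}_{\mathsf{node}}(\Phi_{\mathsf{bound}},\Psi_{\mathsf{class}})$ is formally verifiable: there is an algorithm $A$ such that for every $P\in\mathrm{ARP}_{\mathsf{node}}(\Phi_{\mathsf{bound}},\Psi_{\mathsf{class}})$, given as a finite description, if $P$ holds then $A(P)=\top$ (completeness), and if $A(P)=\top$ then $P$ holds (soundness), where $A$ terminates on every input with answer $\top$ or $\bot$. -/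

import Mathlib

namespace MPNNVerif

noncomputable section

/-! ### Finite descriptions: rational numbers, neural networks, MPNN, specifications -/

/-- A finite description of a rational number: the pair `(p, q)` describes `p / (q + 1)`. -/
abbrev RatCode : Type := ℤ × ℕ

/-- The rational number described by `(p, q)`, as a real number. -/
def RatCode.val (c : RatCode) : ℝ := (c.1 : ℝ) / ((c.2 : ℝ) + 1)

/-- A neuron: its rational input weights and its rational bias. -/
abbrev Neuron : Type := List RatCode × RatCode

/-- A feed-forward neural network with rational parameters: the list of its layers, each of which
is a list of neurons. All neurons use the ReLU activation. -/
abbrev NN : Type := List (List Neuron)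

/-- A node-classifier MPNN: the dimension of the input labels, the networks `N₁, …, N_k` of the
combination functions of its layers, and the network of its readout function. -/
structure MPNN where
  inDim : ℕ
  layers : List NN
  readout : NN

/-- A linear inequality `c₁ x_{i₁} + ⋯ + c_r x_{i_r} ≤ b` with rational constants, described by the
list of all `(c_l, i_l)` and by `b`. -/
abbrev LinIneq : Type := List (RatCode × ℕ) × RatCode

/-- A vector specification: a finite conjunction of linear inequalities. -/
abbrev VecSpec : Type := List LinIneq

/-- A graph-node specification: a bound `degBound` on the degree of the graph, and a finite list of
label constraints `(r, ψ)`, each saying that all nodes of distance at most `r` from the centre node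
satisfy the vector specification `ψ`. -/
structure InputSpec where
  degBound : ℕ
  constraints : List (ℕ × VecSpec)

/-- A class-assignment output specification
`⋁_{i ∈ I} ⋀_{j ∈ I ∖ {i}} x_i > x_j`, described by a list of the elements of `I`. -/
structure ClassSpec where
  index : List ℕ

/-- The data of an adversarial robustness property of a node-classifier MPNN. -/
structure ARP where
  net : MPNN
  input : InputSpec
  output : ClassSpec

/-! Encodings of these finite descriptions. -/

instance : Primcodable MPNN :=
  Primcodable.ofEquiv (ℕ × List NN × NN)
    { toFun := fun N => (N.inDim, N.layers, N.readout)
      invFun := fun t => ⟨t.1, t.2.1, t.2.2⟩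
      left_inv := fun _ => rfl
      right_inv := fun _ => rfl }

instance : Primcodable InputSpec :=
  Primcodable.ofEquiv (ℕ × List (ℕ × VecSpec))
    { toFun := fun φ => (φ.degBound, φ.constraints)
      invFun := fun t => ⟨t.1, t.2⟩
      left_inv := fun _ => rfl
      right_inv := fun _ => rfl }

instance : Primcodable ClassSpec :=
  Primcodable.ofEquiv (List ℕ)
    { toFun := fun ψ => ψ.index
      invFun := fun t => ⟨t⟩
      left_inv := fun _ => rfl
      right_inv := fun _ => rfl }

instance : Primcodable ARP :=
  Primcodable.ofEquiv (MPNN × InputSpec × ClassSpec)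
    { toFun := fun P => (P.net, P.input, P.output)
      invFun := fun t => ⟨t.1, t.2.1, t.2.2⟩
      left_inv := fun _ => rfl
      right_inv := fun _ => rfl }

/-! ### Graphs

Vectors of `ℝⁿ` are lists of `n` real numbers; the `i`-th coordinate of `x` is `x.getD i 0`. -/

/-- A finite undirected graph (loops are allowed) whose nodes are labelled by vectors of `ℝⁿ`. -/
structure LabeledGraph (n : ℕ) where
  V : Type
  [fintypeV : Fintype V]
  adj : V → V → Prop
  symm : ∀ u v, adj u v → adj v u
  label : V → List ℝ
  length_label : ∀ v, (label v).length = n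

attribute [instance] LabeledGraph.fintypeV

namespace LabeledGraph

variable {n : ℕ} (G : LabeledGraph n)

open Classical in
/-- The neighbourhood of a node. -/
def neigh (v : G.V) : Finset G.V := {u | G.adj v u}

/-- The degree of a graph: the least `d` such that every node has at most `d` neighbours. -/
def degree : ℕ := Finset.univ.sup fun v => (G.neigh v).card

/-- `G.ball v r` is the set of all nodes of distance at most `r` from `v`. -/
def ball (v : G.V) : ℕ → Set G.V
  | 0 => {v}
  | r + 1 => {u | u ∈ ball v r ∨ ∃ w ∈ ball v r, G.adj w u}

end LabeledGraph

/-! ### Semantics of networks and MPNN -/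

/-- The output of a neuron: ReLU of the weighted sum of the inputs plus the bias. -/
def Neuron.eval (ν : Neuron) (x : List ℝ) : ℝ :=
  max 0 ((List.zipWith (fun c t => RatCode.val c * t) ν.1 x).sum + RatCode.val ν.2)

/-- The function computed by a network, layer by layer. -/
def NN.eval (N : NN) (x : List ℝ) : List ℝ :=
  N.foldl (fun y layer => layer.map fun ν => Neuron.eval ν y) x

/-- The sum of a finite multiset of vectors of dimension `n`. -/
def vecSum (n : ℕ) (M : Multiset (List ℝ)) : List ℝ :=
  (List.range n).map fun i => (M.map fun y => y.getD i 0).sum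

/-- One MPNN layer on a graph: the vector of `v` is replaced by `N(x_v, ∑_{u ∈ Neigh(v)} x_u)`. -/
def layerStep {n : ℕ} (G : LabeledGraph n) (x : G.V → List ℝ) (N : NN) : G.V → List ℝ :=
  fun v => NN.eval N (x v ++ vecSum (x v).length ((G.neigh v).val.map x))

/-- The output `N(G, v)` of a node-classifier MPNN `N`. -/
def MPNN.eval (N : MPNN) (G : LabeledGraph N.inDim) (v : G.V) : List ℝ :=
  NN.eval N.readout (N.layers.foldl (layerStep G) G.label v)

/-! ### Semantics of specifications -/

/-- A vector satisfies a linear inequality. -/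
def LinIneq.Sat (e : LinIneq) (x : List ℝ) : Prop :=
  (e.1.map fun t => RatCode.val t.1 * x.getD t.2 0).sum ≤ RatCode.val e.2

/-- A vector satisfies a vector specification. -/
def VecSpec.Sat (ψ : VecSpec) (x : List ℝ) : Prop :=
  ∀ e ∈ ψ, LinIneq.Sat e x

/-- A graph with a centre node satisfies a graph-node specification. -/
def InputSpec.Sat (φ : InputSpec) {n : ℕ} (G : LabeledGraph n) (v : G.V) : Prop :=
  G.degree ≤ φ.degBound ∧ ∀ c ∈ φ.constraints, ∀ u ∈ G.ball v c.1, VecSpec.Sat c.2 (G.label u)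

/-- A vector satisfies `⋁_{i ∈ I} ⋀_{j ∈ I ∖ {i}} x_i > x_j`. -/
def ClassSpec.Sat (ψ : ClassSpec) (y : List ℝ) : Prop :=
  ∃ i ∈ ψ.index, ∀ j ∈ ψ.index, j ≠ i → y.getD i 0 > y.getD j 0

/-- The adversarial robustness property holds: every valid input is mapped to a valid output. -/
def ARP.Holds (P : ARP) : Prop :=
  ∀ (G : LabeledGraph P.net.inDim) (v : G.V),
    P.input.Sat G v → P.output.Sat (P.net.eval G v)

/-! ### Matching dimensions -/

/-- The network `N` has input dimension `n` and output dimension `m`. -/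
def NN.HasDims : NN → ℕ → ℕ → Prop
  | [], n, m => n = m
  | layer :: N, n, m => (∀ ν ∈ layer, ν.1.length = n) ∧ NN.HasDims N layer.length m

/-- The networks `N₁, …, N_k` of MPNN layers fit together and map vectors of dimension `n` to
vectors of dimension `m`: the input of each network is a pair of vectors of the same dimension. -/
def LayersHaveDims : List NN → ℕ → ℕ → Prop
  | [], n, m => n = m
  | N :: Ns, n, m => ∃ p, NN.HasDims N (2 * n) p ∧ LayersHaveDims Ns p m

/-- `N` is a well-formed node-classifier MPNN with output dimension `m`. -/
def MPNN.HasOutDim (N : MPNN) (m : ℕ) : Prop :=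
  ∃ p, LayersHaveDims N.layers N.inDim p ∧ NN.HasDims N.readout p m

/-- The graph-node specifications over labels of dimension `n` that bound the degree by `d` and
constrain only labels of nodes of distance at most `k` from the centre. -/
def PhiBoundDK (n d k : ℕ) : Set InputSpec :=
  {φ | φ.degBound = d ∧
    ∀ c ∈ φ.constraints, c.1 ≤ k ∧ ∀ e ∈ c.2, ∀ t ∈ e.1, t.2 < n}

/-- All degree-bounded graph-node specifications over labels of dimension `n`. -/
def PhiBound (n : ℕ) : Set InputSpec := ⋃ (d : ℕ) (k : ℕ), PhiBoundDK n d k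

/-- The class-assignment specifications over vectors of dimension `m`. -/
def PsiClass (m : ℕ) : Set ClassSpec := {ψ | ∀ i ∈ ψ.index, i < m}

/-- The adversarial robustness properties `(N, φ, ψ)` of node-classifier MPNN `N` with
`φ ∈ Φ` and `ψ ∈ Ψ` for sets `Φ`, `Ψ` of specifications (of vectors of each dimension). -/
def ARPnode (Φ : ℕ → Set InputSpec) (Ψ : ℕ → Set ClassSpec) : Set ARP :=
  {P | P.input ∈ Φ P.net.inDim ∧ ∃ m, P.net.HasOutDim m ∧ P.output ∈ Ψ m}

/-- A set `S` of safety properties is formally verifiable: some algorithm `A` is complete and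
sound on all members of `S`. -/
def FormallyVerifiable {α : Type} [Primcodable α] (Holds : α → Prop) (S : Set α) : Prop :=
  ∃ A : α → Bool, Computable A ∧
    ∀ P ∈ S, (Holds P → A P = true) ∧ (A P = true → Holds P)

end

end MPNNVerif

-- A violated property always has a counterexample of bounded size, and the counterexamples of a
-- given size form the solution set of finitely many systems of rational linear inequalities.
--
-- Locality gives the bound. After `k` layers the vector of `v` depends only on the ball of radius
-- `k` around `v`, which has at most `(d + 1) ^ k` nodes if the degree is at most `d`. Restricting a
-- counterexample to this ball preserves the output, does not raise the degree and brings no node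
-- closer to `v`, so the label constraints survive (`ARP.exists_small_counterexample`).
--
-- For fixed number of nodes and fixed centre, edges, marks for balls and vectors at all times
-- become real variables. Disjunctions of linear inequalities then express the choice of edges, the
-- sums over the unknown neighbourhoods, ReLU and the failure of the output specification
-- (`ARP.clauses`). A solution yields a counterexample (`ARP.not_holds_of_sat`) and a numbered
-- counterexample yields a solution (`ARP.exists_sat`).
--
-- Satisfiability over the reals is decided by choosing one inequality from every disjunction
-- (`LinCNF.sat_iff_exists_choices`) and applying Fourier–Motzkin elimination
-- (`LinForm.satSystem_elim`, `LinForm.feasible_iff`) with exact rational coefficients. The whole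
-- procedure consists of maps, folds and bounded searches over lists, so it is even primitive
-- recursive (`ARP.primrec_verify`).

attribute [fun_prop] Primrec
attribute [fun_prop] Primrec.id Primrec.const Primrec.comp Primrec.pair

/-! ### Closure properties of primitive recursive functions, in the form used by `fun_prop`. -/

namespace Primrec

variable {α β γ σ : Type*} [Primcodable α] [Primcodable β] [Primcodable γ] [Primcodable σ]

@[fun_prop]
theorem fun_id : Primrec fun a : α => a := Primrec.id

@[fun_prop]
theorem fun_fst {f : α → β × γ} (hf : Primrec f) : Primrec fun a => (f a).1 := fst.comp hf

@[fun_prop]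
theorem fun_snd {f : α → β × γ} (hf : Primrec f) : Primrec fun a => (f a).2 := snd.comp hf

@[fun_prop]
theorem fun_some {f : α → β} (hf : Primrec f) : Primrec fun a => some (f a) :=
  option_some.comp hf

@[fun_prop]
theorem fun_add {f g : α → ℕ} (hf : Primrec f) (hg : Primrec g) : Primrec fun a => f a + g a :=
  nat_add.comp hf hg

@[fun_prop]
theorem fun_mul {f g : α → ℕ} (hf : Primrec f) (hg : Primrec g) : Primrec fun a => f a * g a :=
  nat_mul.comp hf hg

@[fun_prop]
theorem fun_min {f g : α → ℕ} (hf : Primrec f) (hg : Primrec g) :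
    Primrec fun a => min (f a) (g a) :=
  nat_min.comp hf hg

@[fun_prop]
theorem fun_pow {f g : α → ℕ} (hf : Primrec f) (hg : Primrec g) : Primrec fun a => f a ^ g a :=
  (Primrec₂.unpaired'.1 Nat.Primrec.pow).comp hf hg

@[fun_prop]
theorem fun_map {f : α → List β} {g : α → β → γ} (hf : Primrec f)
    (hg : Primrec fun p : α × β => g p.1 p.2) : Primrec fun a => (f a).map (g a) :=
  list_map hf hg

@[fun_prop]
theorem fun_flatMap {f : α → List β} {g : α → β → List γ} (hf : Primrec f)
    (hg : Primrec fun p : α × β => g p.1 p.2) : Primrec fun a => (f a).flatMap (g a) :=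
  list_flatMap hf hg

@[fun_prop]
theorem fun_foldr {f : α → List β} {g : α → σ} {h : α → β → σ → σ} (hf : Primrec f)
    (hg : Primrec g) (hh : Primrec fun p : α × β × σ => h p.1 p.2.1 p.2.2) :
    Primrec fun a => (f a).foldr (h a) (g a) :=
  list_foldr hf hg (h := fun a p => h a p.1 p.2) hh

@[fun_prop]
theorem fun_foldl {f : α → List β} {g : α → σ} {h : α → σ → β → σ} (hf : Primrec f)
    (hg : Primrec g) (hh : Primrec fun p : α × σ × β => h p.1 p.2.1 p.2.2) :
    Primrec fun a => (f a).foldl (h a) (g a) :=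
  list_foldl hf hg (h := fun a p => h a p.1 p.2) hh

@[fun_prop]
theorem fun_range {f : α → ℕ} (hf : Primrec f) : Primrec fun a => List.range (f a) :=
  list_range.comp hf

@[fun_prop]
theorem fun_cons {f : α → β} {g : α → List β} (hf : Primrec f) (hg : Primrec g) :
    Primrec fun a => f a :: g a :=
  list_cons.comp hf hg

@[fun_prop]
theorem fun_append {f g : α → List β} (hf : Primrec f) (hg : Primrec g) :
    Primrec fun a => f a ++ g a :=
  list_append.comp hf hg

@[fun_prop]
theorem fun_length {f : α → List β} (hf : Primrec f) : Primrec fun a => (f a).length :=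
  list_length.comp hf

@[fun_prop]
theorem fun_getD {f : α → List β} {g : α → ℕ} {d : β} (hf : Primrec f) (hg : Primrec g) :
    Primrec fun a => (f a).getD (g a) d :=
  (list_getD d).comp hf hg

@[fun_prop]
theorem fun_optionElim {o : α → Option β} {f : α → σ} {g : α → β → σ} (ho : Primrec o)
    (hf : Primrec f) (hg : Primrec fun p : α × β => g p.1 p.2) :
    Primrec fun a => (o a).elim (f a) (g a) :=
  (option_casesOn ho hf (g := g) hg).of_eq fun a => by cases o a <;> rfl

@[fun_prop]
theorem fun_ite_eq [DecidableEq β] {u v : α → β} {f g : α → σ} (hu : Primrec u) (hv : Primrec v)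
    (hf : Primrec f) (hg : Primrec g) : Primrec fun a => if u a = v a then f a else g a :=
  ite (Primrec.eq.comp hu hv) hf hg

@[fun_prop]
theorem fun_ite_lt {u v : α → ℕ} {f g : α → σ} (hu : Primrec u) (hv : Primrec v)
    (hf : Primrec f) (hg : Primrec g) : Primrec fun a => if u a < v a then f a else g a :=
  ite (nat_lt.comp hu hv) hf hg

@[fun_prop]
theorem fun_decide_le {u v : α → ℕ} (hu : Primrec u) (hv : Primrec v) :
    Primrec fun a => decide (u a ≤ v a) :=
  PrimrecPred.decide (nat_le.comp hu hv)

@[fun_prop]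
theorem fun_not {f : α → Bool} (hf : Primrec f) : Primrec fun a => !f a :=
  Primrec.not.comp hf

@[fun_prop]
theorem fun_all {f : α → List β} {p : α → β → Bool} (hf : Primrec f)
    (hp : Primrec fun q : α × β => p q.1 q.2) : Primrec fun a => (f a).all (p a) := by
  have h : Primrec fun a => (f a).foldr (fun b s => p a b && s) true :=
    fun_foldr hf (const true) (h := fun a b s => p a b && s)
      (Primrec.and.comp (hp.comp (fst.pair (fst.comp snd))) (snd.comp snd))
  exact h.of_eq fun a => by induction f a with
    | nil => rfl
    | cons b l ih => simp [ih]

@[fun_prop]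
theorem fun_any {f : α → List β} {p : α → β → Bool} (hf : Primrec f)
    (hp : Primrec fun q : α × β => p q.1 q.2) : Primrec fun a => (f a).any (p a) := by
  have h : Primrec fun a => !(f a).all fun b => !p a b :=
    fun_not (fun_all hf (p := fun a b => !p a b) (fun_not hp))
  exact h.of_eq fun a => by simp [List.not_all_eq_any_not]

/-- The encoding of integers stores the sign in the parity of the code: even codes are nonnegative
integers, odd codes negative ones. Splitting an integer into two naturals reduces all later
arithmetic to `ℕ`. -/
theorem int_toNat_pair : Primrec fun z : ℤ => (z.toNat, (-z).toNat) := by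
  refine Primrec.ofNat_iff.2 ?_
  have h : Primrec fun n : ℕ => bif n.bodd then (0, n.div2 + 1) else (n.div2, 0) :=
    cond nat_bodd ((const 0).pair (fun_add nat_div2 (const 1))) (nat_div2.pair (const 0))
  refine h.of_eq fun n => ?_
  have e : Denumerable.ofNat ℤ n = bif n.bodd then Int.negSucc n.div2 else (n.div2 : ℤ) := by
    show Equiv.intEquivNat.symm n = _
    simp only [Equiv.intEquivNat, Equiv.natSumNatEquivNat, Equiv.symm_trans_apply]
    cases hb : n.bodd <;> simp [Equiv.boolProdNatEquivNat, hb] <;> rfl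
  rw [e]
  cases n.bodd <;> simp

end Primrec

namespace MPNNVerif

/-! ### Arithmetic of finite descriptions of rational numbers -/

/-- The triple `(p, q, r)` describes the rational number `(p - q) / (r + 1)`. -/
abbrev Scalar : Type := ℕ × ℕ × ℕ

namespace Scalar

/-- The rational number described by a scalar, as a real number. -/
noncomputable def val (s : Scalar) : ℝ := ((s.1 : ℝ) - s.2.1) / ((s.2.2 : ℝ) + 1)

/-- The sum of two scalars. -/
def add (s t : Scalar) : Scalar :=
  (s.1 * (t.2.2 + 1) + t.1 * (s.2.2 + 1), s.2.1 * (t.2.2 + 1) + t.2.1 * (s.2.2 + 1),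
    s.2.2 * t.2.2 + s.2.2 + t.2.2)

/-- The product of two scalars. -/
def mul (s t : Scalar) : Scalar :=
  (s.1 * t.1 + s.2.1 * t.2.1, s.1 * t.2.1 + s.2.1 * t.1, s.2.2 * t.2.2 + s.2.2 + t.2.2)

/-- The negative of a scalar. -/
def neg (s : Scalar) : Scalar := (s.2.1, s.1, s.2.2)

/-- A natural number as a scalar. -/
def ofNat (n : ℕ) : Scalar := (n, 0, 0)

/-- The scalar with the value of a given description of a rational number. -/
def ofRatCode (c : RatCode) : Scalar := (c.1.toNat, (-c.1).toNat, c.2)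

@[simp]
theorem val_add (s t : Scalar) : (add s t).val = s.val + t.val := by
  have hs : (s.2.2 : ℝ) + 1 ≠ 0 := by positivity
  have ht : (t.2.2 : ℝ) + 1 ≠ 0 := by positivity
  have h : (s.2.2 : ℝ) * t.2.2 + s.2.2 + t.2.2 + 1 = (s.2.2 + 1) * (t.2.2 + 1) := by ring
  simp only [val, add]
  push_cast
  rw [h]
  field_simp
  ring

@[simp]
theorem val_mul (s t : Scalar) : (mul s t).val = s.val * t.val := by
  have hs : (s.2.2 : ℝ) + 1 ≠ 0 := by positivity
  have ht : (t.2.2 : ℝ) + 1 ≠ 0 := by positivity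
  have h : (s.2.2 : ℝ) * t.2.2 + s.2.2 + t.2.2 + 1 = (s.2.2 + 1) * (t.2.2 + 1) := by ring
  simp only [val, mul]
  push_cast
  rw [h]
  field_simp
  ring

@[simp]
theorem val_neg (s : Scalar) : (neg s).val = -s.val := by
  simp only [val, neg]
  ring

@[simp]
theorem val_ofNat (n : ℕ) : (ofNat n).val = n := by simp [val, ofNat]

@[simp]
theorem val_ofRatCode (c : RatCode) : (ofRatCode c).val = RatCode.val c := by
  have h : ((c.1.toNat : ℝ) - (-c.1).toNat) = c.1 := by exact_mod_cast Int.toNat_sub_toNat_neg c.1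
  simp only [val, ofRatCode, RatCode.val, h]

/-- The denominator is positive, so signs are decided by comparing two naturals. Every case
distinction in the elimination rests on this. -/
theorem val_nonpos_iff (s : Scalar) : s.val ≤ 0 ↔ s.1 ≤ s.2.1 := by
  have hs : (0 : ℝ) < (s.2.2 : ℝ) + 1 := by positivity
  rw [val, div_le_iff₀ hs, zero_mul, sub_nonpos, Nat.cast_le]

theorem val_pos_iff (s : Scalar) : 0 < s.val ↔ s.2.1 < s.1 := by
  simpa using (val_nonpos_iff s).not

theorem val_neg_iff (s : Scalar) : s.val < 0 ↔ s.1 < s.2.1 := by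
  have h := val_pos_iff (neg s)
  rwa [val_neg, neg_pos] at h

end Scalar

@[fun_prop]
theorem Scalar.primrec_add {α : Type*} [Primcodable α] {f g : α → Scalar} (hf : Primrec f)
    (hg : Primrec g) : Primrec fun a => Scalar.add (f a) (g a) := by
  unfold Scalar.add
  fun_prop

@[fun_prop]
theorem Scalar.primrec_mul {α : Type*} [Primcodable α] {f g : α → Scalar} (hf : Primrec f)
    (hg : Primrec g) : Primrec fun a => Scalar.mul (f a) (g a) := by
  unfold Scalar.mul
  fun_prop

@[fun_prop]
theorem Scalar.primrec_neg {α : Type*} [Primcodable α] {f : α → Scalar} (hf : Primrec f) :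
    Primrec fun a => Scalar.neg (f a) := by
  unfold Scalar.neg
  fun_prop

@[fun_prop]
theorem Scalar.primrec_ofNat {α : Type*} [Primcodable α] {f : α → ℕ} (hf : Primrec f) :
    Primrec fun a => Scalar.ofNat (f a) := by
  unfold Scalar.ofNat
  fun_prop

@[fun_prop]
theorem Scalar.primrec_ofRatCode {α : Type*} [Primcodable α] {f : α → RatCode} (hf : Primrec f) :
    Primrec fun a => Scalar.ofRatCode (f a) := by
  have h : Primrec fun a => ((f a).1.toNat, (-(f a).1).toNat) :=
    Primrec.int_toNat_pair.comp (Primrec.fun_fst hf)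
  exact (Primrec.fun_fst h).pair ((Primrec.fun_snd h).pair (Primrec.fun_snd hf))

/-! ### Linear forms and Fourier–Motzkin elimination -/

/-- A linear form with rational coefficients in variables from `V`. -/
abbrev LinForm (V : Type) : Type := List (Scalar × V)

namespace LinForm

variable {V : Type}

/-- The value of a linear form under an assignment. -/
noncomputable def eval (x : V → ℝ) (e : LinForm V) : ℝ := (e.map fun t => t.1.val * x t.2).sum

/-- The multiple of a linear form by a scalar. -/
def smul (c : Scalar) (e : LinForm V) : LinForm V := e.map fun t => (Scalar.mul c t.1, t.2)

@[simp]
theorem eval_nil (x : V → ℝ) : eval x [] = 0 := rfl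

@[simp]
theorem eval_cons (x : V → ℝ) (t : Scalar × V) (e : LinForm V) :
    eval x (t :: e) = t.1.val * x t.2 + eval x e := by simp [eval]

@[simp]
theorem eval_append (x : V → ℝ) (e f : LinForm V) : eval x (e ++ f) = eval x e + eval x f := by
  simp [eval]

@[simp]
theorem eval_smul (x : V → ℝ) (c : Scalar) (e : LinForm V) :
    eval x (smul c e) = c.val * eval x e := by
  induction e with
  | nil => simp [smul]
  | cons t e ih =>
    have : smul c (t :: e) = (Scalar.mul c t.1, t.2) :: smul c e := rfl
    rw [this, eval_cons, eval_cons, ih, Scalar.val_mul]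
    ring

theorem eval_congr {x y : V → ℝ} {e : LinForm V} (h : ∀ t ∈ e, x t.2 = y t.2) :
    eval x e = eval y e := by
  unfold eval
  congr 1
  exact List.map_congr_left fun t ht => by rw [h t ht]

variable [DecidableEq V]

/-- The coefficient of a variable in a linear form. -/
def coeff (v : V) (e : LinForm V) : Scalar :=
  e.foldr (fun t s => if t.2 = v then Scalar.add t.1 s else s) (0, 0, 0)

/-- The part of a linear form that does not contain a given variable. -/
def erase (v : V) (e : LinForm V) : LinForm V := e.flatMap fun t => if t.2 = v then [] else [t]

theorem ne_of_mem_erase {v : V} {e : LinForm V} {t : Scalar × V} (h : t ∈ erase v e) :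
    t.2 ≠ v := by
  obtain ⟨s, -, hs⟩ := List.mem_flatMap.1 h
  split_ifs at hs with hv
  · simp at hs
  · rwa [List.mem_singleton.1 hs]

/-- A variable may occur several times in a list of terms; `coeff` collects all its occurrences. -/
theorem eval_eq_coeff_add_erase (x : V → ℝ) (v : V) (e : LinForm V) :
    eval x e = (coeff v e).val * x v + eval x (erase v e) := by
  induction e with
  | nil => simp [coeff, erase, Scalar.val]
  | cons t e ih =>
    by_cases h : t.2 = v
    · have h1 : coeff v (t :: e) = Scalar.add t.1 (coeff v e) := by simp [coeff, h]
      have h2 : erase v (t :: e) = erase v e := by simp [erase, h]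
      rw [eval_cons, h1, h2, ih, Scalar.val_add, h]
      ring
    · have h1 : coeff v (t :: e) = coeff v e := by simp [coeff, h]
      have h2 : erase v (t :: e) = t :: erase v e := by simp [erase, h]
      rw [eval_cons, h1, h2, ih, eval_cons]
      ring

theorem eval_update (x : V → ℝ) (v : V) (r : ℝ) (e : LinForm V) :
    eval (Function.update x v r) e = (coeff v e).val * r + eval x (erase v e) := by
  rw [eval_eq_coeff_add_erase _ v, Function.update_self]
  congr 1
  exact eval_congr fun t ht => Function.update_of_ne (ne_of_mem_erase ht) _ _

/-- Fourier–Motzkin elimination of the variable `v` from the system of all `e ≤ 0`, `e ∈ C`. -/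
def elim (C : List (LinForm V)) (v : V) : List (LinForm V) :=
  C.flatMap fun e =>
    if (coeff v e).1 = (coeff v e).2.1 then [erase v e]
    else if (coeff v e).1 < (coeff v e).2.1 then
      C.flatMap fun f =>
        if (coeff v f).2.1 < (coeff v f).1 then
          [smul (coeff v f) (erase v e) ++ smul (Scalar.neg (coeff v e)) (erase v f)]
        else []
    else []

theorem mem_elim {C : List (LinForm V)} {v : V} {g : LinForm V} :
    g ∈ elim C v ↔ (∃ e ∈ C, (coeff v e).val = 0 ∧ g = erase v e) ∨
      ∃ e ∈ C, (coeff v e).val < 0 ∧ ∃ f ∈ C, 0 < (coeff v f).val ∧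
        g = smul (coeff v f) (erase v e) ++ smul (Scalar.neg (coeff v e)) (erase v f) := by
  have h0 : ∀ s : Scalar, s.val = 0 ↔ s.1 = s.2.1 := fun s => by
    have h1 := s.val_neg_iff
    have h2 := s.val_pos_iff
    constructor
    · intro h
      rw [h] at h1 h2
      simp at h1 h2
      omega
    · intro h
      rw [h] at h1 h2
      simp only [lt_irrefl, iff_false, not_lt] at h1 h2
      linarith
  simp only [h0, Scalar.val_neg_iff, Scalar.val_pos_iff, elim, List.mem_flatMap]
  constructor
  · rintro ⟨e, he, hg⟩
    split_ifs at hg with h1 h2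
    · exact Or.inl ⟨e, he, h1, List.mem_singleton.1 hg⟩
    · obtain ⟨f, hf, hg⟩ := List.mem_flatMap.1 hg
      split_ifs at hg with h3
      · exact Or.inr ⟨e, he, h2, f, hf, h3, List.mem_singleton.1 hg⟩
      · simp at hg
    · simp at hg
  · rintro (⟨e, he, h, rfl⟩ | ⟨e, he, h, f, hf, h', rfl⟩)
    · exact ⟨e, he, by simp [h]⟩
    · refine ⟨e, he, ?_⟩
      rw [if_neg h.ne, if_pos h]
      exact List.mem_flatMap.2 ⟨f, hf, by simp [h']⟩

/-- An assignment satisfies the system of all `e ≤ 0`, `e ∈ C`. -/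
def SatSystem (x : V → ℝ) (C : List (LinForm V)) : Prop := ∀ e ∈ C, eval x e ≤ 0

/-- The largest lower bound works if there is one. If `L` is empty, any number below all upper
bounds does; the recursion builds it with `min`. -/
theorem _root_.List.exists_between_of_forall_le {α : Type*} (L U : List α) (l u : α → ℝ)
    (h : ∀ a ∈ L, ∀ b ∈ U, l a ≤ u b) :
    ∃ r, (∀ a ∈ L, l a ≤ r) ∧ ∀ b ∈ U, r ≤ u b := by
  induction L with
  | nil =>
    induction U with
    | nil => exact ⟨0, by simp, by simp⟩
    | cons b U ih =>
      obtain ⟨r, -, hr⟩ := ih (by simp)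
      refine ⟨min r (u b), by simp, fun c hc => ?_⟩
      rcases List.mem_cons.1 hc with rfl | hc
      · exact min_le_right _ _
      · exact (min_le_left _ _).trans (hr c hc)
  | cons a L ih =>
    obtain ⟨r, h1, h2⟩ := ih fun c hc => h c (List.mem_cons_of_mem _ hc)
    refine ⟨max r (l a), fun c hc => ?_, fun b hb => max_le (h2 b hb) (h a (by simp) b hb)⟩
    rcases List.mem_cons.1 hc with rfl | hc
    · exact le_max_right _ _
    · exact (h1 c hc).trans (le_max_left _ _)

/-- Inequalities with negative coefficient at `v` are lower bounds for the value of `v`, those with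
positive coefficient are upper bounds. A value exists exactly if each lower bound is at most each
upper bound; clearing denominators gives the combined forms of `elim`. -/
theorem satSystem_elim {x : V → ℝ} {C : List (LinForm V)} {v : V} :
    SatSystem x (elim C v) ↔ ∃ r, SatSystem (Function.update x v r) C := by
  constructor
  · intro h
    have hle : ∀ e ∈ C.filter (fun e => decide ((coeff v e).1 < (coeff v e).2.1)),
        ∀ f ∈ C.filter (fun e => decide ((coeff v e).2.1 < (coeff v e).1)),
          eval x (erase v e) / -(coeff v e).val ≤ -eval x (erase v f) / (coeff v f).val := by
      intro e he f hf
      rw [List.mem_filter, decide_eq_true_eq, ← Scalar.val_neg_iff] at he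
      rw [List.mem_filter, decide_eq_true_eq, ← Scalar.val_pos_iff] at hf
      have := h _ (mem_elim.2 (Or.inr ⟨e, he.1, he.2, f, hf.1, hf.2, rfl⟩))
      rw [eval_append, eval_smul, eval_smul, Scalar.val_neg] at this
      rw [div_le_div_iff₀ (by linarith [he.2]) hf.2]
      linarith
    obtain ⟨r, h1, h2⟩ := List.exists_between_of_forall_le _ _ _ _ hle
    refine ⟨r, fun e he => ?_⟩
    rw [eval_update]
    rcases lt_trichotomy (coeff v e).val 0 with hc | hc | hc
    · have := h1 e (by simpa [he] using (Scalar.val_neg_iff _).1 hc)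
      rw [div_le_iff₀ (by linarith)] at this
      linarith
    · have := h _ (mem_elim.2 (Or.inl ⟨e, he, hc, rfl⟩))
      rw [hc]
      linarith
    · have := h2 e (by simpa [he] using (Scalar.val_pos_iff _).1 hc)
      rw [le_div_iff₀ hc] at this
      linarith
  · rintro ⟨r, h⟩ g hg
    rcases mem_elim.1 hg with ⟨e, he, hc, rfl⟩ | ⟨e, he, hc, f, hf, hc', rfl⟩
    · have := h e he
      rw [eval_update, hc] at this
      linarith
    · have h1 := h e he
      have h2 := h f hf
      rw [eval_update] at h1 h2
      rw [eval_append, eval_smul, eval_smul, Scalar.val_neg]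
      have h3 := mul_nonneg hc'.le (sub_nonneg.2 h1)
      have h4 := mul_nonneg (neg_nonneg.2 hc.le) (sub_nonneg.2 h2)
      linarith

theorem satSystem_foldl_elim {x : V → ℝ} {C : List (LinForm V)} {vs : List V} :
    SatSystem x (vs.foldl elim C) ↔ ∃ y, (∀ v ∉ vs, y v = x v) ∧ SatSystem y C := by
  induction vs generalizing C with
  | nil =>
    refine ⟨fun h => ⟨x, fun _ _ => rfl, h⟩, ?_⟩
    rintro ⟨y, hy, h⟩
    rwa [show x = y from funext fun v => (hy v (by simp)).symm]
  | cons v vs ih =>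
    rw [List.foldl_cons, ih]
    constructor
    · rintro ⟨y, hy, h⟩
      obtain ⟨r, hr⟩ := satSystem_elim.1 h
      refine ⟨_, fun w hw => ?_, hr⟩
      rw [List.mem_cons, not_or] at hw
      rw [Function.update_of_ne hw.1, hy w hw.2]
    · rintro ⟨y, hy, h⟩
      -- The intermediate assignment must agree with `x` at `v`, which is eliminated first; putting
      -- `y v` back recovers `y`.
      refine ⟨Function.update y v (x v), fun w hw => ?_, satSystem_elim.2 ⟨y v, by simpa using h⟩⟩
      by_cases hv : w = v
      · rw [hv, Function.update_self]
      · rw [Function.update_of_ne hv, hy w (by simp [hv, hw])]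

/-- Whether the system of all `e ≤ 0`, `e ∈ C`, has a solution where the variable `o` is `1`. -/
def feasible (o : V) (C : List (LinForm V)) : Bool :=
  ((C.flatMap fun e => e.flatMap fun t => if t.2 = o then [] else [t.2]).foldl elim C).all
    fun e => decide ((coeff o e).1 ≤ (coeff o e).2.1)

/-- Once all variables of `C` except `o` are eliminated, their values are irrelevant, so it suffices
to test the assignment that is `1` at `o` and `0` elsewhere. There each form evaluates to its
coefficient at `o`. -/
theorem feasible_iff {o : V} {C : List (LinForm V)} :
    feasible o C = true ↔ ∃ x : V → ℝ, x o = 1 ∧ SatSystem x C := by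
  have h0 : ∀ e : LinForm V, (coeff o e).1 ≤ (coeff o e).2.1 ↔ eval (Pi.single o 1) e ≤ 0 := by
    intro e
    have : eval (Pi.single o (1 : ℝ)) e = (coeff o e).val := by
      rw [eval_eq_coeff_add_erase _ o,
        eval_congr (y := fun _ => 0) fun t ht => Pi.single_eq_of_ne (ne_of_mem_erase ht) _]
      simp [eval]
    rw [this, Scalar.val_nonpos_iff]
  set vs := C.flatMap fun e => e.flatMap fun t => if t.2 = o then [] else [t.2] with hvs
  have hmem : ∀ v, v ∈ vs ↔ v ≠ o ∧ ∃ e ∈ C, ∃ t ∈ e, t.2 = v := by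
    intro v
    rw [hvs]
    simp only [List.mem_flatMap]
    constructor
    · rintro ⟨e, he, t, ht, hv⟩
      split_ifs at hv with h
      · simp at hv
      · rw [List.mem_singleton] at hv
        exact ⟨hv ▸ h, e, he, t, ht, hv.symm⟩
    · rintro ⟨hv, e, he, t, ht, rfl⟩
      exact ⟨e, he, t, ht, by simp [hv]⟩
  have h1 : feasible o C = true ↔ SatSystem (Pi.single o 1) (vs.foldl elim C) := by
    simp only [feasible, ← hvs, List.all_eq_true, decide_eq_true_eq, h0, SatSystem]
  rw [h1, satSystem_foldl_elim]
  constructor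
  · rintro ⟨y, hy, h⟩
    exact ⟨y, by rw [hy o (by simp [hmem]), Pi.single_eq_same], h⟩
  · rintro ⟨x, hx, h⟩
    refine ⟨fun v => if v ∈ vs then x v else (Pi.single o 1 : V → ℝ) v,
      fun v hv => if_neg hv, fun e he => ?_⟩
    -- Each variable occurring in `C` is `o` or lies in `vs`, so resetting all other variables
    -- changes no value.
    rw [eval_congr (y := x)]
    · exact h e he
    · intro t ht
      by_cases ho : t.2 = o
      · have : o ∉ vs := by simp [hmem]
        simp only [ho, this, if_false, Pi.single_eq_same, hx]
      · have : t.2 ∈ vs := (hmem _).2 ⟨ho, e, he, t, ht, rfl⟩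
        simp only [this, if_true]

end LinForm

/-! ### Conjunctions of disjunctions of linear inequalities -/

/-- A conjunction of disjunctions of linear inequalities `e ≤ 0`. -/
abbrev LinCNF (V : Type) : Type := List (List (LinForm V))

namespace LinCNF

variable {V : Type}

/-- An assignment satisfies a conjunction of disjunctions of linear inequalities. -/
def Sat (x : V → ℝ) (F : LinCNF V) : Prop := ∀ c ∈ F, ∃ e ∈ c, LinForm.eval x e ≤ 0

@[simp]
theorem sat_nil (x : V → ℝ) : Sat x [] := by simp [Sat]

@[simp]
theorem sat_cons (x : V → ℝ) (c : List (LinForm V)) (F : LinCNF V) :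
    Sat x (c :: F) ↔ (∃ e ∈ c, LinForm.eval x e ≤ 0) ∧ Sat x F := by simp [Sat]

@[simp]
theorem sat_append (x : V → ℝ) (F F' : LinCNF V) : Sat x (F ++ F') ↔ Sat x F ∧ Sat x F' := by
  simp [Sat, or_imp, forall_and]

@[simp]
theorem sat_flatMap {α : Type*} (x : V → ℝ) (l : List α) (f : α → LinCNF V) :
    Sat x (l.flatMap f) ↔ ∀ a ∈ l, Sat x (f a) := by
  simp only [Sat, List.mem_flatMap]
  exact ⟨fun h a ha c hc => h c ⟨a, ha, hc⟩, fun h c ⟨a, ha, hc⟩ => h a ha c hc⟩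

/-- All choices of one inequality from each disjunction. -/
def choices (F : LinCNF V) : List (List (LinForm V)) :=
  F.foldr (fun c s => c.flatMap fun e => s.map fun l => e :: l) [[]]

theorem sat_iff_exists_choices {x : V → ℝ} {F : LinCNF V} :
    Sat x F ↔ ∃ C ∈ choices F, ∀ e ∈ C, LinForm.eval x e ≤ 0 := by
  induction F with
  | nil => simp [choices]
  | cons c F ih =>
    have : choices (c :: F) = c.flatMap fun e => (choices F).map fun l => e :: l := rfl
    rw [sat_cons, ih, this]
    simp only [List.mem_flatMap, List.mem_map]
    constructor
    · rintro ⟨⟨e, he, h⟩, C, hC, h'⟩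
      exact ⟨_, ⟨e, he, C, hC, rfl⟩, by simpa [h] using h'⟩
    · rintro ⟨_, ⟨e, he, C, hC, rfl⟩, h⟩
      rw [List.forall_mem_cons] at h
      exact ⟨⟨e, he, h.1⟩, C, hC, h.2⟩

/-- Whether `F` has a satisfying assignment where the variable `o` is `1`. -/
def satisfiable [DecidableEq V] (o : V) (F : LinCNF V) : Bool :=
  (choices F).any fun C => LinForm.feasible o C

theorem satisfiable_iff [DecidableEq V] {o : V} {F : LinCNF V} :
    satisfiable o F = true ↔ ∃ x : V → ℝ, x o = 1 ∧ Sat x F := by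
  simp only [satisfiable, List.any_eq_true, LinForm.feasible_iff, sat_iff_exists_choices,
    LinForm.SatSystem]
  constructor
  · rintro ⟨C, hC, x, hx, h⟩
    exact ⟨x, hx, C, hC, h⟩
  · rintro ⟨x, hx, C, hC, h⟩
    exact ⟨C, hC, x, hx, h⟩

end LinCNF

/-! ### Primitive recursiveness of elimination and of the satisfiability test. -/

section Primrec

variable {α V : Type} [Primcodable α] [Primcodable V]

@[fun_prop]
theorem LinForm.primrec_smul {c : α → Scalar} {e : α → LinForm V} (hc : Primrec c)
    (he : Primrec e) : Primrec fun a => LinForm.smul (c a) (e a) := by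
  unfold LinForm.smul
  fun_prop

variable [DecidableEq V]

@[fun_prop]
theorem LinForm.primrec_coeff {v : α → V} {e : α → LinForm V} (hv : Primrec v)
    (he : Primrec e) : Primrec fun a => LinForm.coeff (v a) (e a) := by
  unfold LinForm.coeff
  fun_prop

@[fun_prop]
theorem LinForm.primrec_erase {v : α → V} {e : α → LinForm V} (hv : Primrec v)
    (he : Primrec e) : Primrec fun a => LinForm.erase (v a) (e a) := by
  unfold LinForm.erase
  fun_prop

@[fun_prop]
theorem LinForm.primrec_elim {C : α → List (LinForm V)} {v : α → V} (hC : Primrec C)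
    (hv : Primrec v) : Primrec fun a => LinForm.elim (C a) (v a) := by
  unfold LinForm.elim
  fun_prop

@[fun_prop]
theorem LinForm.primrec_feasible {o : α → V} {C : α → List (LinForm V)} (ho : Primrec o)
    (hC : Primrec C) : Primrec fun a => LinForm.feasible (o a) (C a) := by
  unfold LinForm.feasible
  fun_prop

@[fun_prop]
theorem LinCNF.primrec_satisfiable {o : α → V} {F : α → LinCNF V} (ho : Primrec o)
    (hF : Primrec F) : Primrec fun a => LinCNF.satisfiable (o a) (F a) := by
  unfold LinCNF.satisfiable LinCNF.choices
  fun_prop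

end Primrec

end MPNNVerif

namespace MPNNVerif

/-! ### Locality: balls, induced subgraphs and small counterexamples. -/

namespace LabeledGraph

variable {n : ℕ} {G : LabeledGraph n}

theorem mem_neigh {u v : G.V} : u ∈ G.neigh v ↔ G.adj v u := by
  simp [neigh]

theorem card_neigh_le_degree (G : LabeledGraph n) (v : G.V) : (G.neigh v).card ≤ G.degree :=
  Finset.le_sup (f := fun v => (G.neigh v).card) (Finset.mem_univ v)

theorem ball_subset_ball_succ (G : LabeledGraph n) (v : G.V) (r : ℕ) :
    G.ball v r ⊆ G.ball v (r + 1) :=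
  fun _ hu => Or.inl hu

theorem ball_mono (G : LabeledGraph n) (v : G.V) : Monotone (G.ball v) :=
  monotone_nat_of_le_succ (G.ball_subset_ball_succ v)

theorem center_mem_ball (G : LabeledGraph n) (v : G.V) (r : ℕ) : v ∈ G.ball v r :=
  G.ball_mono v (Nat.zero_le r) (Set.mem_singleton v)

theorem mem_ball_succ_of_adj {u v w : G.V} {r : ℕ} (hu : u ∈ G.ball v r) (h : G.adj u w) :
    w ∈ G.ball v (r + 1) :=
  Or.inr ⟨u, hu, h⟩

/-- Each unit of radius adds at most `d` neighbours per node already present, a factor of `d + 1`.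
-/
theorem ncard_ball_le {d : ℕ} (h : G.degree ≤ d) (v : G.V) (r : ℕ) :
    (G.ball v r).ncard ≤ (d + 1) ^ r := by
  classical
  induction r with
  | zero => simp [ball]
  | succ r ih =>
    set B : Finset G.V := (G.ball v r).toFinset with hB
    have hsub : G.ball v (r + 1) ⊆ ↑(B ∪ B.biUnion G.neigh) := by
      intro u hu
      rcases hu with hu | ⟨w, hw, hu⟩
      · simp [hB, hu]
      · simp only [Finset.coe_union, Finset.coe_biUnion, Set.mem_union, Set.mem_iUnion]
        exact Or.inr ⟨w, by simpa [hB] using hw, Finset.mem_coe.2 (mem_neigh.2 hu)⟩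
    have hcard : B.card ≤ (d + 1) ^ r := by rwa [hB, ← Set.ncard_eq_toFinset_card']
    calc (G.ball v (r + 1)).ncard ≤ (B ∪ B.biUnion G.neigh).card := by
          rw [← Set.ncard_coe_finset]
          exact Set.ncard_le_ncard hsub (Finset.finite_toSet _)
      _ ≤ B.card + B.card * d :=
          (Finset.card_union_le _ _).trans (Nat.add_le_add_left
            (Finset.card_biUnion_le_card_mul _ _ _
              fun u _ => (G.card_neigh_le_degree u).trans h) _)
      _ = B.card * (d + 1) := by ring
      _ ≤ (d + 1) ^ (r + 1) := by
          rw [pow_succ]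
          exact Nat.mul_le_mul_right _ hcard

/-- The subgraph induced by a set of nodes. -/
noncomputable def induce (G : LabeledGraph n) (B : Set G.V) : LabeledGraph n where
  V := B
  fintypeV := Fintype.ofFinite B
  adj u w := G.adj u.1 w.1
  symm u w h := G.symm u.1 w.1 h
  label u := G.label u.1
  length_label u := G.length_label u.1

variable {B : Set G.V}

/-- The inclusion of the nodes of an induced subgraph. -/
def inclusion (G : LabeledGraph n) (B : Set G.V) : (G.induce B).V ↪ G.V :=
  Function.Embedding.subtype fun u => u ∈ B

theorem card_induce (G : LabeledGraph n) (B : Set G.V) :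
    Fintype.card (G.induce B).V = B.ncard := by
  rw [Fintype.card_eq_nat_card]
  rfl

theorem map_neigh_induce_subset (u : (G.induce B).V) :
    ((G.induce B).neigh u).map (G.inclusion B) ⊆ G.neigh (G.inclusion B u) := by
  intro w hw
  obtain ⟨z, hz, rfl⟩ := Finset.mem_map.1 hw
  exact mem_neigh.2 ((mem_neigh (G := G.induce B)).1 hz)

theorem map_neigh_induce {u : (G.induce B).V} (h : ∀ w, G.adj (G.inclusion B u) w → w ∈ B) :
    ((G.induce B).neigh u).map (G.inclusion B) = G.neigh (G.inclusion B u) := by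
  refine (map_neigh_induce_subset u).antisymm fun w hw => ?_
  have hw := mem_neigh.1 hw
  exact Finset.mem_map.2 ⟨⟨w, h w hw⟩, mem_neigh.2 hw, rfl⟩

theorem degree_induce_le (G : LabeledGraph n) (B : Set G.V) : (G.induce B).degree ≤ G.degree := by
  refine Finset.sup_le fun u _ => ?_
  have h := Finset.card_le_card (map_neigh_induce_subset u)
  rw [Finset.card_map] at h
  exact h.trans (G.card_neigh_le_degree _)

/-- Paths of the subgraph are paths of `G`. Hence label constraints of any radius pass to the
subgraph, and their radii do not enter the size bound. -/
theorem inclusion_mem_ball {u v : (G.induce B).V} {r : ℕ} (h : u ∈ (G.induce B).ball v r) :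
    G.inclusion B u ∈ G.ball (G.inclusion B v) r := by
  induction r generalizing u with
  | zero =>
    rw [Set.mem_singleton_iff.1 h]
    exact G.center_mem_ball _ _
  | succ r ih =>
    rcases h with h | ⟨w, hw, h⟩
    · exact G.ball_subset_ball_succ _ _ (ih h)
    · exact mem_ball_succ_of_adj (ih hw) h

/-- The two runs agree on a ball whose radius shrinks by one with each layer: a node strictly inside
the current ball has all its neighbours in that ball and in `B`, so both graphs aggregate the same
multiset. -/
theorem foldl_layerStep_induce {v : G.V} {r : ℕ} {Ns : List NN} {X : G.V → List ℝ}
    {Y : (G.induce B).V → List ℝ} (hB : G.ball v (r + Ns.length) ⊆ B)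
    (hXY : ∀ u, G.inclusion B u ∈ G.ball v (r + Ns.length) → Y u = X (G.inclusion B u))
    (u : (G.induce B).V) (hu : G.inclusion B u ∈ G.ball v r) :
    Ns.foldl (layerStep (G.induce B)) Y u = Ns.foldl (layerStep G) X (G.inclusion B u) := by
  induction Ns generalizing X Y with
  | nil => exact hXY u hu
  | cons N Ns ih =>
    rw [List.length_cons, ← add_assoc] at hB hXY
    refine ih ((G.ball_subset_ball_succ v _).trans hB) fun w hw => ?_
    have hw' : Y w = X (G.inclusion B w) := hXY w (G.ball_subset_ball_succ v _ hw)
    have hm : ((G.induce B).neigh w).val.map Y = (G.neigh (G.inclusion B w)).val.map X := by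
      rw [← map_neigh_induce fun z hz => hB (mem_ball_succ_of_adj hw hz), Finset.map_val,
        Multiset.map_map]
      exact Multiset.map_congr rfl fun z hz =>
        hXY z (mem_ball_succ_of_adj hw ((mem_neigh (G := G.induce B)).1 hz))
    rw [layerStep, layerStep, hw', hm]

end LabeledGraph

/-- A violated property has a counterexample with at most `(d + 1) ^ k` nodes, where `d` bounds the
degree and `k` is the number of layers. -/
theorem ARP.exists_small_counterexample {P : ARP} (h : ¬ P.Holds) :
    ∃ (G : LabeledGraph P.net.inDim) (v : G.V),
      Fintype.card G.V ≤ (P.input.degBound + 1) ^ P.net.layers.length ∧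
        P.input.Sat G v ∧ ¬ P.output.Sat (P.net.eval G v) := by
  simp only [ARP.Holds, not_forall] at h
  obtain ⟨G, v, hin, hout⟩ := h
  set B := G.ball v P.net.layers.length with hB
  refine ⟨G.induce B, ⟨v, G.center_mem_ball _ _⟩, ?_,
    ⟨(G.degree_induce_le B).trans hin.1, fun c hc u hu => ?_⟩, ?_⟩
  · rw [G.card_induce]
    exact LabeledGraph.ncard_ball_le hin.1 v _
  · exact hin.2 c hc _ (LabeledGraph.inclusion_mem_ball hu)
  · convert hout using 2
    unfold MPNN.eval
    congr 1
    exact LabeledGraph.foldl_layerStep_induce (v := v) (r := 0)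
      (by rw [zero_add]) (fun u _ => rfl) _ (Set.mem_singleton v)

end MPNNVerif

namespace MPNNVerif

/-! ### Programs: the flattened form of an MPNN -/

/-- An instruction is an aggregation (`none`) or a layer of neurons applied at each node. -/
abbrev Instr : Type := Option (List Neuron)

/-- The dimension of the vectors after an instruction. -/
def Instr.outDim (n : ℕ) (a : Instr) : ℕ := a.elim (n + n) List.length

/-- The effect of an instruction on the vectors of the nodes. -/
noncomputable def Instr.step {n : ℕ} (G : LabeledGraph n) (X : G.V → List ℝ) (a : Instr) :
    G.V → List ℝ :=
  a.elim (fun v => X v ++ vecSum (X v).length ((G.neigh v).val.map X))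
    fun L v => L.map fun ν => Neuron.eval ν (X v)

/-- The sequence of instructions that an MPNN performs. -/
def MPNN.program (N : MPNN) : List Instr :=
  (N.layers.flatMap fun L => none :: L.map fun l => some l) ++ N.readout.map fun l => some l

theorem foldl_step_map_some {n : ℕ} (G : LabeledGraph n) (L : NN) (X : G.V → List ℝ) :
    (L.map fun l => some l).foldl (Instr.step G) X = fun v => NN.eval L (X v) := by
  induction L generalizing X with
  | nil => rfl
  | cons l L ih =>
    rw [List.map_cons, List.foldl_cons, ih]
    rfl

theorem MPNN.eval_eq_foldl_program (N : MPNN) (G : LabeledGraph N.inDim) (v : G.V) :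
    N.eval G v = N.program.foldl (Instr.step G) G.label v := by
  rw [MPNN.program, List.foldl_append, foldl_step_map_some, MPNN.eval]
  congr 2
  generalize G.label = X
  induction N.layers generalizing X with
  | nil => rfl
  | cons L Ns ih =>
    rw [List.flatMap_cons, List.foldl_append, List.foldl_cons, List.foldl_cons,
      foldl_step_map_some, ih]
    rfl

/-! ### Variables -/

/-- The variables of the linear constraints that describe a counterexample. -/
abbrev Var : Type := ℕ × ℕ × ℕ × ℕ × ℕ

namespace Var

/-- The variable with value `1`. -/
def one : Var := (0, 0, 0, 0, 0)

/-- The variable for the adjacency of the nodes `u` and `w`. -/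
def adj (u w : ℕ) : Var := (1, u, w, 0, 0)

/-- The variable for the node `u` being of distance at most `r` from the centre. -/
def near (r u : ℕ) : Var := (2, r, u, 0, 0)

/-- The variable for the `i`-th coordinate of the vector of the node `u` at time `t`. -/
def state (t u i : ℕ) : Var := (3, t, u, i, 0)

/-- The variable for the contribution of the node `w` to the `i`-th coordinate of the sum over the
neighbours of the node `u` at time `t`. -/
def msg (t u w i : ℕ) : Var := (4, t, u, w, i)

end Var

/-- The linear form of a variable. -/
def LinForm.ofVar (v : Var) : LinForm Var := [(Scalar.ofNat 1, v)]

/-- The constant linear form, expressed by the variable with value `1`. -/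
def LinForm.const (s : Scalar) : LinForm Var := [(s, Var.one)]

/-- The linear form `g` such that `g ≤ 0` expresses `e ≤ f`. -/
def LinForm.le (e f : LinForm Var) : LinForm Var :=
  e ++ LinForm.smul (Scalar.neg (Scalar.ofNat 1)) f

/-- Two inequalities that express `e = f`. -/
def LinCNF.eq (e f : LinForm Var) : LinCNF Var := [[LinForm.le e f], [LinForm.le f e]]

section eval

variable {x : Var → ℝ}

@[simp]
theorem LinForm.eval_ofVar (v : Var) : LinForm.eval x (LinForm.ofVar v) = x v := by
  simp [LinForm.ofVar]

/-- Elimination works with homogeneous forms; constants enter as multiples of a variable fixed to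
`1`. -/
theorem LinForm.eval_const (h1 : x Var.one = 1) (s : Scalar) :
    LinForm.eval x (LinForm.const s) = s.val := by
  simp [LinForm.const, h1]

@[simp]
theorem LinForm.eval_le_nonpos (e f : LinForm Var) :
    LinForm.eval x (LinForm.le e f) ≤ 0 ↔ LinForm.eval x e ≤ LinForm.eval x f := by
  simp [LinForm.le]

@[simp]
theorem LinCNF.sat_eq (e f : LinForm Var) :
    LinCNF.Sat x (LinCNF.eq e f) ↔ LinForm.eval x e = LinForm.eval x f := by
  simp [LinCNF.eq, le_antisymm_iff]

theorem LinForm.eval_map_range (n : ℕ) (s : ℕ → Scalar) (v : ℕ → Var) :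
    LinForm.eval x ((List.range n).map fun i => (s i, v i)) =
      ∑ i ∈ Finset.range n, (s i).val * x (v i) := by
  rw [LinForm.eval, List.map_map]
  rfl

end eval

/-! ### Constraints -/

/-- The `i`-th coordinate of the vector of dimension `n` of the node `u` at time `t`. -/
def coord (n t u i : ℕ) : LinForm Var := if i < n then LinForm.ofVar (Var.state t u i) else []

/-- The adjacency variables describe a graph with `M` nodes and degree at most `d`. -/
def adjClauses (M d : ℕ) : LinCNF Var :=
  (List.range M).flatMap fun u =>
    [LinForm.le ((List.range M).map fun w => (Scalar.ofNat 1, Var.adj u w))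
      (LinForm.const (Scalar.ofNat d))] ::
    (List.range M).flatMap fun w =>
      [[LinForm.le (LinForm.ofVar (Var.adj u w)) [],
          LinForm.le (LinForm.const (Scalar.ofNat 1)) (LinForm.ofVar (Var.adj u w))],
        [LinForm.le [] (LinForm.ofVar (Var.adj u w))],
        [LinForm.le (LinForm.ofVar (Var.adj u w)) (LinForm.ofVar (Var.adj w u))]]

/-- All nodes of distance at most `r` from `c` are marked as such. -/
def nearClauses (M c r : ℕ) : LinCNF Var :=
  [LinForm.le (LinForm.const (Scalar.ofNat 1)) (LinForm.ofVar (Var.near 0 c))] ::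
  (List.range r).flatMap fun s => (List.range M).flatMap fun u =>
    [LinForm.le (LinForm.ofVar (Var.near s u)) [],
      LinForm.le (LinForm.const (Scalar.ofNat 1)) (LinForm.ofVar (Var.near (s + 1) u))] ::
    (List.range M).flatMap fun w =>
      [[LinForm.le (LinForm.ofVar (Var.near s u)) [],
        LinForm.le (LinForm.ofVar (Var.adj u w)) [],
        LinForm.le (LinForm.const (Scalar.ofNat 1)) (LinForm.ofVar (Var.near (s + 1) w))]]

/-- The label of each marked node satisfies a vector specification. -/
def labelClauses (n M : ℕ) (c : ℕ × VecSpec) : LinCNF Var :=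
  (List.range M).flatMap fun u => c.2.flatMap fun e =>
    [[LinForm.le (LinForm.ofVar (Var.near c.1 u)) [],
      LinForm.le (e.1.flatMap fun t => LinForm.smul (Scalar.ofRatCode t.1) (coord n 0 u t.2))
        (LinForm.const (Scalar.ofRatCode e.2))]]

/-- The effect of an aggregation at time `t` on vectors of dimension `n`. -/
def aggregateClauses (M t n : ℕ) : LinCNF Var :=
  (List.range M).flatMap fun u => (List.range n).flatMap fun i =>
    LinCNF.eq (LinForm.ofVar (Var.state (t + 1) u i)) (LinForm.ofVar (Var.state t u i)) ++
    LinCNF.eq (LinForm.ofVar (Var.state (t + 1) u (n + i)))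
      ((List.range M).map fun w => (Scalar.ofNat 1, Var.msg t u w i)) ++
    (List.range M).flatMap fun w =>
      [[LinForm.le (LinForm.const (Scalar.ofNat 1)) (LinForm.ofVar (Var.adj u w)),
          LinForm.le (LinForm.ofVar (Var.msg t u w i)) []],
        [LinForm.le (LinForm.const (Scalar.ofNat 1)) (LinForm.ofVar (Var.adj u w)),
          LinForm.le [] (LinForm.ofVar (Var.msg t u w i))],
        [LinForm.le (LinForm.ofVar (Var.adj u w)) [],
          LinForm.le (LinForm.ofVar (Var.msg t u w i)) (LinForm.ofVar (Var.state t w i))],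
        [LinForm.le (LinForm.ofVar (Var.adj u w)) [],
          LinForm.le (LinForm.ofVar (Var.state t w i)) (LinForm.ofVar (Var.msg t u w i))]]

/-- The value of a neuron before the activation, at the node `u` and time `t`. -/
def neuronForm (t n u : ℕ) (ν : Neuron) : LinForm Var :=
  ((List.range (min ν.1.length n)).map fun i =>
    (Scalar.ofRatCode (ν.1.getD i (0, 0)), Var.state t u i)) ++
  LinForm.const (Scalar.ofRatCode ν.2)

/-- The effect of a layer of neurons at time `t` on vectors of dimension `n`. -/
def layerClauses (M t n : ℕ) (L : List Neuron) : LinCNF Var :=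
  (List.range M).flatMap fun u => (List.range L.length).flatMap fun j =>
    [[LinForm.le [] (LinForm.ofVar (Var.state (t + 1) u j))],
      [LinForm.le (neuronForm t n u (L.getD j ([], (0, 0))))
        (LinForm.ofVar (Var.state (t + 1) u j))],
      [LinForm.le (LinForm.ofVar (Var.state (t + 1) u j)) [],
        LinForm.le (LinForm.ofVar (Var.state (t + 1) u j))
          (neuronForm t n u (L.getD j ([], (0, 0))))]]

/-- The effect of an instruction at time `t` on vectors of dimension `n`. -/
def instrClauses (M t n : ℕ) (a : Instr) : LinCNF Var :=
  a.elim (aggregateClauses M t n) fun L => layerClauses M t n L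

/-- The final time, the final dimension, and the constraints for a sequence of instructions. -/
def programClauses (M n : ℕ) (p : List Instr) : ℕ × ℕ × LinCNF Var :=
  p.foldl (fun s a => (s.1 + 1, Instr.outDim s.2.1 a, s.2.2 ++ instrClauses M s.1 s.2.1 a))
    (0, n, [])

/-- The vector of dimension `m` of the node `c` at time `t` violates a class specification. -/
def outputClauses (t m c : ℕ) (I : List ℕ) : LinCNF Var :=
  I.flatMap fun i => [I.flatMap fun j =>
    if j = i then [] else [LinForm.le (coord m t c i) (coord m t c j)]]

/-- The constraints that describe the counterexamples with `M` nodes and centre node `c`. -/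
def ARP.clauses (P : ARP) (M c : ℕ) : LinCNF Var :=
  adjClauses M P.input.degBound ++
  (P.input.constraints.flatMap fun q => nearClauses M c q.1 ++ labelClauses P.net.inDim M q) ++
  (programClauses M P.net.inDim P.net.program).2.2 ++
  outputClauses (programClauses M P.net.inDim P.net.program).1
    (programClauses M P.net.inDim P.net.program).2.1 c P.output.index

/-- Whether a property has no counterexample of bounded size. -/
def ARP.verify (P : ARP) : Bool :=
  !(List.range ((P.input.degBound + 1) ^ P.net.layers.length + 1)).any fun M =>
    (List.range M).any fun c => LinCNF.satisfiable Var.one (P.clauses M c)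

/-! ### The constraints are computable -/

section Primrec

variable {α : Type} [Primcodable α]

@[fun_prop]
theorem ARP.primrec_net {f : α → ARP} (hf : Primrec f) : Primrec fun a => (f a).net :=
  (Primrec.fst.comp Primrec.of_equiv).comp hf

@[fun_prop]
theorem ARP.primrec_input {f : α → ARP} (hf : Primrec f) : Primrec fun a => (f a).input :=
  ((Primrec.fst.comp Primrec.snd).comp Primrec.of_equiv).comp hf

@[fun_prop]
theorem ARP.primrec_output {f : α → ARP} (hf : Primrec f) : Primrec fun a => (f a).output :=
  ((Primrec.snd.comp Primrec.snd).comp Primrec.of_equiv).comp hf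

@[fun_prop]
theorem MPNN.primrec_inDim {f : α → MPNN} (hf : Primrec f) : Primrec fun a => (f a).inDim :=
  (Primrec.fst.comp Primrec.of_equiv).comp hf

@[fun_prop]
theorem MPNN.primrec_layers {f : α → MPNN} (hf : Primrec f) : Primrec fun a => (f a).layers :=
  ((Primrec.fst.comp Primrec.snd).comp Primrec.of_equiv).comp hf

@[fun_prop]
theorem MPNN.primrec_readout {f : α → MPNN} (hf : Primrec f) : Primrec fun a => (f a).readout :=
  ((Primrec.snd.comp Primrec.snd).comp Primrec.of_equiv).comp hf

@[fun_prop]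
theorem InputSpec.primrec_degBound {f : α → InputSpec} (hf : Primrec f) :
    Primrec fun a => (f a).degBound :=
  (Primrec.fst.comp Primrec.of_equiv).comp hf

@[fun_prop]
theorem InputSpec.primrec_constraints {f : α → InputSpec} (hf : Primrec f) :
    Primrec fun a => (f a).constraints :=
  (Primrec.snd.comp Primrec.of_equiv).comp hf

@[fun_prop]
theorem ClassSpec.primrec_index {f : α → ClassSpec} (hf : Primrec f) :
    Primrec fun a => (f a).index :=
  Primrec.of_equiv.comp hf

@[fun_prop]
theorem MPNN.primrec_program {f : α → MPNN} (hf : Primrec f) : Primrec fun a => (f a).program := by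
  unfold MPNN.program
  fun_prop

variable {M t n u w i c r : α → ℕ}

@[fun_prop]
theorem Instr.primrec_outDim {a : α → Instr} (hn : Primrec n) (ha : Primrec a) :
    Primrec fun b => Instr.outDim (n b) (a b) := by
  unfold Instr.outDim
  fun_prop

@[fun_prop]
theorem Var.primrec_adj (hu : Primrec u) (hw : Primrec w) :
    Primrec fun a => Var.adj (u a) (w a) := by
  unfold Var.adj
  fun_prop

@[fun_prop]
theorem Var.primrec_near (hr : Primrec r) (hu : Primrec u) :
    Primrec fun a => Var.near (r a) (u a) := by
  unfold Var.near
  fun_prop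

@[fun_prop]
theorem Var.primrec_state (ht : Primrec t) (hu : Primrec u) (hi : Primrec i) :
    Primrec fun a => Var.state (t a) (u a) (i a) := by
  unfold Var.state
  fun_prop

@[fun_prop]
theorem Var.primrec_msg (ht : Primrec t) (hu : Primrec u) (hw : Primrec w) (hi : Primrec i) :
    Primrec fun a => Var.msg (t a) (u a) (w a) (i a) := by
  unfold Var.msg
  fun_prop

@[fun_prop]
theorem LinForm.primrec_ofVar {v : α → Var} (hv : Primrec v) :
    Primrec fun a => LinForm.ofVar (v a) := by
  unfold LinForm.ofVar
  fun_prop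

@[fun_prop]
theorem LinForm.primrec_const {s : α → Scalar} (hs : Primrec s) :
    Primrec fun a => LinForm.const (s a) := by
  unfold LinForm.const
  fun_prop

@[fun_prop]
theorem LinForm.primrec_le {e f : α → LinForm Var} (he : Primrec e) (hf : Primrec f) :
    Primrec fun a => LinForm.le (e a) (f a) := by
  unfold LinForm.le
  fun_prop

@[fun_prop]
theorem LinCNF.primrec_eq {e f : α → LinForm Var} (he : Primrec e) (hf : Primrec f) :
    Primrec fun a => LinCNF.eq (e a) (f a) := by
  unfold LinCNF.eq
  fun_prop

@[fun_prop]
theorem primrec_coord (hn : Primrec n) (ht : Primrec t) (hu : Primrec u) (hi : Primrec i) :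
    Primrec fun a => coord (n a) (t a) (u a) (i a) := by
  unfold coord
  fun_prop

@[fun_prop]
theorem primrec_adjClauses {d : α → ℕ} (hM : Primrec M) (hd : Primrec d) :
    Primrec fun a => adjClauses (M a) (d a) := by
  unfold adjClauses
  fun_prop

@[fun_prop]
theorem primrec_nearClauses (hM : Primrec M) (hc : Primrec c) (hr : Primrec r) :
    Primrec fun a => nearClauses (M a) (c a) (r a) := by
  unfold nearClauses
  fun_prop

@[fun_prop]
theorem primrec_labelClauses {q : α → ℕ × VecSpec} (hn : Primrec n) (hM : Primrec M)
    (hq : Primrec q) : Primrec fun a => labelClauses (n a) (M a) (q a) := by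
  unfold labelClauses
  fun_prop

@[fun_prop]
theorem primrec_aggregateClauses (hM : Primrec M) (ht : Primrec t) (hn : Primrec n) :
    Primrec fun a => aggregateClauses (M a) (t a) (n a) := by
  unfold aggregateClauses
  fun_prop

@[fun_prop]
theorem primrec_neuronForm {ν : α → Neuron} (ht : Primrec t) (hn : Primrec n) (hu : Primrec u)
    (hν : Primrec ν) : Primrec fun a => neuronForm (t a) (n a) (u a) (ν a) := by
  unfold neuronForm
  fun_prop

@[fun_prop]
theorem primrec_layerClauses {L : α → List Neuron} (hM : Primrec M) (ht : Primrec t)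
    (hn : Primrec n) (hL : Primrec L) :
    Primrec fun a => layerClauses (M a) (t a) (n a) (L a) := by
  unfold layerClauses
  fun_prop

@[fun_prop]
theorem primrec_instrClauses {a : α → Instr} (hM : Primrec M) (ht : Primrec t)
    (hn : Primrec n) (ha : Primrec a) :
    Primrec fun b => instrClauses (M b) (t b) (n b) (a b) := by
  unfold instrClauses
  fun_prop

@[fun_prop]
theorem primrec_programClauses {p : α → List Instr} (hM : Primrec M) (hn : Primrec n)
    (hp : Primrec p) : Primrec fun a => programClauses (M a) (n a) (p a) := by
  unfold programClauses
  fun_prop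

@[fun_prop]
theorem primrec_outputClauses {m : α → ℕ} {I : α → List ℕ} (ht : Primrec t) (hm : Primrec m)
    (hc : Primrec c) (hI : Primrec I) :
    Primrec fun a => outputClauses (t a) (m a) (c a) (I a) := by
  unfold outputClauses
  fun_prop

@[fun_prop]
theorem ARP.primrec_clauses {P : α → ARP} (hP : Primrec P) (hM : Primrec M) (hc : Primrec c) :
    Primrec fun a => (P a).clauses (M a) (c a) := by
  unfold ARP.clauses
  fun_prop

end Primrec

theorem ARP.primrec_verify : Primrec ARP.verify := by
  unfold ARP.verify
  fun_prop

end MPNNVerif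

namespace MPNNVerif

/-! ### Meaning of the constraints -/

section sat

variable {x : Var → ℝ}

/-- An adjacency variable is `0` or at least `1`, not necessarily equal to `1`. This suffices: the
row sum still bounds the number of neighbours from above. -/
theorem sat_adjClauses (h1 : x Var.one = 1) {M d : ℕ} :
    LinCNF.Sat x (adjClauses M d) ↔ ∀ u < M,
      ∑ w ∈ Finset.range M, x (Var.adj u w) ≤ d ∧ ∀ w < M,
      (x (Var.adj u w) ≤ 0 ∨ 1 ≤ x (Var.adj u w)) ∧ 0 ≤ x (Var.adj u w) ∧
        x (Var.adj u w) ≤ x (Var.adj w u) := by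
  simp [adjClauses, LinForm.eval_map_range, LinForm.eval_const h1]

/-- Only one implication is imposed: nodes of the ball are marked, but others may be too.
Superfluous marks only add label constraints, so every solution still gives a valid input. -/
theorem sat_nearClauses (h1 : x Var.one = 1) {M c r : ℕ} :
    LinCNF.Sat x (nearClauses M c r) ↔
      1 ≤ x (Var.near 0 c) ∧ ∀ s < r, ∀ u < M,
      (x (Var.near s u) ≤ 0 ∨ 1 ≤ x (Var.near (s + 1) u)) ∧ ∀ w < M,
        x (Var.near s u) ≤ 0 ∨ x (Var.adj u w) ≤ 0 ∨ 1 ≤ x (Var.near (s + 1) w) := by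
  simp [nearClauses, LinForm.eval_const h1]

theorem sat_labelClauses (h1 : x Var.one = 1) {n M : ℕ} {q : ℕ × VecSpec} :
    LinCNF.Sat x (labelClauses n M q) ↔
      ∀ u < M, x (Var.near q.1 u) ≤ 0 ∨
      VecSpec.Sat q.2 ((List.range n).map fun i => x (Var.state 0 u i)) := by
  have h : ∀ (l : List (RatCode × ℕ)) (u : ℕ),
      LinForm.eval x (l.flatMap fun t => LinForm.smul (Scalar.ofRatCode t.1) (coord n 0 u t.2)) =
        (l.map fun t => RatCode.val t.1 *
          ((List.range n).map fun i => x (Var.state 0 u i)).getD t.2 0).sum := by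
    intro l u
    induction l with
    | nil => simp
    | cons t l ih =>
      rw [List.flatMap_cons, LinForm.eval_append, ih, List.map_cons, List.sum_cons,
        LinForm.eval_smul, Scalar.val_ofRatCode, coord]
      congr 2
      -- Out of range, the empty form has value `0`, matching the default of `getD`.
      split_ifs with ht
      · simp [ht]
      · simp [List.getD, List.getElem?_eq_none (l := List.range n) (by simpa using ht)]
  simp only [labelClauses, LinCNF.sat_flatMap, List.mem_range, LinCNF.sat_cons, List.mem_cons,
    List.not_mem_nil, or_false, exists_eq_or_imp, exists_eq_left, LinForm.eval_le_nonpos,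
    LinForm.eval_ofVar, LinForm.eval_nil, h, LinForm.eval_const h1, Scalar.val_ofRatCode,
    LinCNF.sat_nil, and_true, VecSpec.Sat, LinIneq.Sat]
  refine forall₂_congr fun u _ => ?_
  by_cases hx : x (Var.near q.1 u) ≤ 0 <;> simp [hx]

/-- The product of an adjacency variable and a state would be quadratic. The message variable
replaces it, and the case distinction on the edge keeps the constraints linear. -/
theorem sat_aggregateClauses (h1 : x Var.one = 1) {M t n : ℕ} :
    LinCNF.Sat x (aggregateClauses M t n) ↔
    ∀ u < M, ∀ i < n, x (Var.state (t + 1) u i) = x (Var.state t u i) ∧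
      x (Var.state (t + 1) u (n + i)) = ∑ w ∈ Finset.range M, x (Var.msg t u w i) ∧ ∀ w < M,
        (1 ≤ x (Var.adj u w) ∨ x (Var.msg t u w i) = 0) ∧
        (x (Var.adj u w) ≤ 0 ∨ x (Var.msg t u w i) = x (Var.state t w i)) := by
  simp [aggregateClauses, LinForm.eval_map_range, LinForm.eval_const h1, le_antisymm_iff,
    or_and_left, and_assoc]

theorem eval_neuronForm (h1 : x Var.one = 1) {t n u : ℕ} {ν : Neuron} :
    max 0 (LinForm.eval x (neuronForm t n u ν)) =
      Neuron.eval ν ((List.range n).map fun i => x (Var.state t u i)) := by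
  -- The `min` in `neuronForm` reproduces the truncation by `zipWith`.
  have h : List.zipWith (fun c s => RatCode.val c * s) ν.1
        ((List.range n).map fun i => x (Var.state t u i)) =
      (List.range (min ν.1.length n)).map fun i =>
        RatCode.val (ν.1.getD i (0, 0)) * x (Var.state t u i) := by
    refine List.ext_getElem (by simp) fun i hi _ => ?_
    have hi : i < ν.1.length := by
      rw [List.length_zipWith] at hi
      omega
    simp [List.getD, List.getElem?_eq_getElem hi]
  rw [Neuron.eval, h, neuronForm, LinForm.eval_append, LinForm.eval_map_range,
    LinForm.eval_const h1]
  simp only [Scalar.val_ofRatCode]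
  rfl

theorem sat_layerClauses (h1 : x Var.one = 1) {M t n : ℕ} {L : List Neuron} :
    LinCNF.Sat x (layerClauses M t n L) ↔ ∀ u < M, ∀ j < L.length,
      x (Var.state (t + 1) u j) = Neuron.eval (L.getD j ([], (0, 0)))
        ((List.range n).map fun i => x (Var.state t u i)) := by
  have h : ∀ a b : ℝ, 0 ≤ a ∧ b ≤ a ∧ (a ≤ 0 ∨ a ≤ b) ↔ a = max 0 b := by
    intro a b
    rw [le_antisymm_iff, max_le_iff, le_max_iff]
    tauto
  simp only [← eval_neuronForm h1, ← h]
  simp [layerClauses]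

theorem sat_outputClauses {t m c : ℕ} {I : List ℕ} : LinCNF.Sat x (outputClauses t m c I) ↔
    ¬ ClassSpec.Sat ⟨I⟩ ((List.range m).map fun i => x (Var.state t c i)) := by
  have h : ∀ i, LinForm.eval x (coord m t c i) =
      ((List.range m).map fun i => x (Var.state t c i)).getD i 0 := by
    intro i
    rw [coord]
    split_ifs with hi
    · simp [hi]
    · simp [List.getD, List.getElem?_eq_none (l := List.range m) (by simpa using hi)]
  simp only [outputClauses, LinCNF.sat_flatMap, LinCNF.sat_cons, LinCNF.sat_nil, and_true,
    ClassSpec.Sat, not_exists, not_and, not_forall, not_lt, gt_iff_lt, List.mem_flatMap, ← h]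
  refine forall₂_congr fun i _ => ⟨?_, ?_⟩
  · rintro ⟨e, ⟨j, hj, he⟩, hle⟩
    split_ifs at he with hji
    · simp at he
    · rw [List.mem_singleton.1 he, LinForm.eval_le_nonpos] at hle
      exact ⟨j, hj, hji, hle⟩
  · rintro ⟨j, hj, hji, hle⟩
    exact ⟨_, ⟨j, hj, by rw [if_neg hji]; exact List.mem_singleton_self _⟩,
      (LinForm.eval_le_nonpos _ _).2 hle⟩

end sat

/-! ### Assignments that describe a run of a program on a graph -/

section run

variable {n₀ : ℕ} {G : LabeledGraph n₀} {M : ℕ} (e : G.V ≃ Fin M) {x : Var → ℝ}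

theorem forall_lt_iff_forall_node {p : ℕ → Prop} : (∀ k < M, p k) ↔ ∀ u : G.V, p (e u) :=
  ⟨fun h u => h _ (e u).2, fun h k hk => by simpa using h (e.symm ⟨k, hk⟩)⟩

theorem sum_range_eq_sum_node (f : ℕ → ℝ) : ∑ k ∈ Finset.range M, f k = ∑ u : G.V, f (e u) := by
  rw [← Fin.sum_univ_eq_sum_range, ← e.sum_comp]

/-- The state variables at time `t` describe the vectors `X`, which have dimension `n`. -/
def Represents (x : Var → ℝ) (t n : ℕ) (X : G.V → List ℝ) : Prop :=
  ∀ u, X u = (List.range n).map fun i => x (Var.state t (e u) i)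

/-- The adjacency variables describe the edges of the graph. -/
def RepresentsAdj (x : Var → ℝ) : Prop :=
  ∀ u w : G.V, (G.adj u w → 1 ≤ x (Var.adj (e u) (e w))) ∧
    (¬ G.adj u w → x (Var.adj (e u) (e w)) ≤ 0)

variable {e}

/-- Cutting the `n + n` coordinates in the middle separates the node's own vector from the neighbour
sum. -/
theorem Represents.step_none_iff {t n : ℕ} {X : G.V → List ℝ} (hX : Represents e x t n X) :
    Represents e x (t + 1) (n + n) (Instr.step G X none) ↔ ∀ u : G.V, ∀ i < n,
      x (Var.state (t + 1) (e u) i) = x (Var.state t (e u) i) ∧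
      x (Var.state (t + 1) (e u) (n + i)) = ∑ w ∈ G.neigh u, x (Var.state t (e w) i) := by
  refine forall_congr' fun u => ?_
  have h2 : vecSum (X u).length ((G.neigh u).val.map X) =
      (List.range n).map fun i => ∑ w ∈ G.neigh u, x (Var.state t (e w) i) := by
    have hlen : (X u).length = n := by simp [hX u]
    rw [vecSum, hlen]
    refine List.map_congr_left fun i hi => ?_
    rw [Multiset.map_map, Finset.sum]
    congr 1
    refine Multiset.map_congr rfl fun w _ => ?_
    simp [hX w, List.mem_range.1 hi]
  have happ : ∀ {a b c d : List ℝ}, a.length = c.length → (a ++ b = c ++ d ↔ a = c ∧ b = d) :=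
    fun hl => ⟨fun h => List.append_inj h hl, fun h => by rw [h.1, h.2]⟩
  have h3 : Instr.step G X none u = X u ++ vecSum (X u).length ((G.neigh u).val.map X) := rfl
  rw [h3, h2, hX u, List.range_add, List.map_append, List.map_map,
    happ (by simp)]
  simp only [List.map_inj_left, List.mem_range, Function.comp_apply]
  constructor
  · exact fun h i hi => ⟨(h.1 i hi).symm, (h.2 i hi).symm⟩
  · exact fun h => ⟨fun i hi => (h i hi).1.symm, fun i hi => (h i hi).2.symm⟩

theorem Represents.step_some_iff {t n : ℕ} {X : G.V → List ℝ} (hX : Represents e x t n X)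
    (L : List Neuron) :
    Represents e x (t + 1) L.length (Instr.step G X (some L)) ↔ ∀ u : G.V, ∀ j < L.length,
      x (Var.state (t + 1) (e u) j) = Neuron.eval (L.getD j ([], (0, 0)))
        ((List.range n).map fun i => x (Var.state t (e u) i)) := by
  refine forall_congr' fun u => ?_
  have h3 : Instr.step G X (some L) u =
      (List.range L.length).map fun j => Neuron.eval (L.getD j ([], (0, 0))) (X u) := by
    refine List.ext_getElem (by simp [Instr.step]) fun j hj _ => ?_
    have hj : j < L.length := by simpa [Instr.step] using hj
    simp [Instr.step, List.getD, List.getElem?_eq_getElem hj]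
  rw [h3, ← hX u]
  simp only [List.map_inj_left, List.mem_range]
  exact forall₂_congr fun j _ => eq_comm

/-- Satisfied constraints of an instruction determine its result. -/
theorem Represents.step_of_sat (h1 : x Var.one = 1) (hadj : RepresentsAdj e x) {t n : ℕ}
    {X : G.V → List ℝ} (hX : Represents e x t n X) {a : Instr}
    (h : LinCNF.Sat x (instrClauses M t n a)) :
    Represents e x (t + 1) (Instr.outDim n a) (Instr.step G X a) := by
  cases a with
  | none =>
    have h := (sat_aggregateClauses h1).1 h
    rw [forall_lt_iff_forall_node e] at h
    refine hX.step_none_iff.2 fun u i hi => ?_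
    obtain ⟨hl, hr, hm⟩ := h u i hi
    refine ⟨hl, hr.trans ?_⟩
    rw [forall_lt_iff_forall_node e] at hm
    -- Messages from non-neighbours vanish, so the sum over all nodes is the sum over the
    -- neighbourhood.
    rw [sum_range_eq_sum_node e, ← Finset.sum_subset (Finset.subset_univ (G.neigh u))]
    · refine Finset.sum_congr rfl fun w hw => (hm w).2.resolve_left ?_
      linarith [(hadj u w).1 (LabeledGraph.mem_neigh.1 hw)]
    · intro w _ hw
      refine (hm w).1.resolve_left ?_
      linarith [(hadj u w).2 (mt LabeledGraph.mem_neigh.2 hw)]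
  | some L =>
    have h := (sat_layerClauses h1).1 h
    rw [forall_lt_iff_forall_node e] at h
    exact (hX.step_some_iff L).2 h

/-- The result of an instruction satisfies its constraints. -/
theorem Represents.sat_of_step (h1 : x Var.one = 1) (hadj : RepresentsAdj e x) {t n : ℕ}
    (hmsg : ∀ (u w : G.V) i, (G.adj u w → x (Var.msg t (e u) (e w) i) = x (Var.state t (e w) i)) ∧
      (¬ G.adj u w → x (Var.msg t (e u) (e w) i) = 0))
    {X : G.V → List ℝ} (hX : Represents e x t n X) {a : Instr}
    (h : Represents e x (t + 1) (Instr.outDim n a) (Instr.step G X a)) :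
    LinCNF.Sat x (instrClauses M t n a) := by
  cases a with
  | none =>
    have h := hX.step_none_iff.1 h
    refine (sat_aggregateClauses h1).2 ((forall_lt_iff_forall_node e).2 fun u i hi => ?_)
    obtain ⟨hl, hr⟩ := h u i hi
    refine ⟨hl, hr.trans ?_, (forall_lt_iff_forall_node e).2 fun w => ?_⟩
    · rw [sum_range_eq_sum_node e, ← Finset.sum_subset (Finset.subset_univ (G.neigh u))]
      · exact Finset.sum_congr rfl fun w hw =>
          ((hmsg u w i).1 (LabeledGraph.mem_neigh.1 hw)).symm
      · exact fun w _ hw => (hmsg u w i).2 (mt LabeledGraph.mem_neigh.2 hw)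
    · by_cases hw : G.adj u w
      · exact ⟨Or.inl ((hadj u w).1 hw), Or.inr ((hmsg u w i).1 hw)⟩
      · exact ⟨Or.inr ((hmsg u w i).2 hw), Or.inl ((hadj u w).2 hw)⟩
  | some L =>
    have h := (hX.step_some_iff L).1 h
    exact (sat_layerClauses h1).2 ((forall_lt_iff_forall_node e).2 h)

theorem programClauses_append_singleton (M n : ℕ) (p : List Instr) (a : Instr) :
    programClauses M n (p ++ [a]) =
      ((programClauses M n p).1 + 1, Instr.outDim (programClauses M n p).2.1 a,
        (programClauses M n p).2.2 ++
          instrClauses M (programClauses M n p).1 (programClauses M n p).2.1 a) := by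
  simp only [programClauses, List.foldl_append, List.foldl_cons, List.foldl_nil]

theorem programClauses_fst (M n : ℕ) (p : List Instr) : (programClauses M n p).1 = p.length := by
  induction p using List.reverseRecOn with
  | nil => rfl
  | append_singleton p a ih => simp [programClauses_append_singleton, ih]

theorem Represents.program_of_sat (h1 : x Var.one = 1) (hadj : RepresentsAdj e x) {n : ℕ}
    {X : G.V → List ℝ} (hX : Represents e x 0 n X) {p : List Instr}
    (h : LinCNF.Sat x (programClauses M n p).2.2) :
    Represents e x (programClauses M n p).1 (programClauses M n p).2.1
      (p.foldl (Instr.step G) X) := by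
  induction p using List.reverseRecOn with
  | nil => exact hX
  | append_singleton p a ih =>
    rw [programClauses_append_singleton] at h ⊢
    rw [LinCNF.sat_append] at h
    rw [List.foldl_append, List.foldl_cons, List.foldl_nil]
    exact (ih h.1).step_of_sat h1 hadj h.2

theorem Represents.length_step {t n : ℕ} {X : G.V → List ℝ} (hX : Represents e x t n X)
    (a : Instr) (u : G.V) : (Instr.step G X a u).length = Instr.outDim n a := by
  cases a <;> simp [Instr.step, Instr.outDim, vecSum, hX u]

/-- The state variables are fixed by the run of the whole program `p`, so the induction is over
prefixes `q` of `p`, extended on the right by one instruction. -/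
theorem Represents.sat_program (h1 : x Var.one = 1) (hadj : RepresentsAdj e x)
    (hmsg : ∀ t (u w : G.V) i,
      (G.adj u w → x (Var.msg t (e u) (e w) i) = x (Var.state t (e w) i)) ∧
      (¬ G.adj u w → x (Var.msg t (e u) (e w) i) = 0))
    {n : ℕ} {X : G.V → List ℝ} {p : List Instr} (hlen : ∀ u, (X u).length = n)
    (hstate : ∀ t (u : G.V) i,
      x (Var.state t (e u) i) = ((p.take t).foldl (Instr.step G) X u).getD i 0)
    (q : List Instr) (hq : q <+: p) :
    Represents e x (programClauses M n q).1 (programClauses M n q).2.1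
      (q.foldl (Instr.step G) X) ∧ LinCNF.Sat x (programClauses M n q).2.2 := by
  have hgetD : ∀ (l : List ℝ), l = (List.range l.length).map fun i => l.getD i 0 := fun l =>
    List.ext_getElem (by simp) fun i hi _ => by simp [List.getD, List.getElem?_eq_getElem hi]
  have hrep : ∀ q : List Instr, q <+: p → ∀ k,
      (∀ u, (q.foldl (Instr.step G) X u).length = k) →
        Represents e x q.length k (q.foldl (Instr.step G) X) := by
    intro q hq k hk u
    have := hstate q.length u
    -- Cutting `p` at time `q.length` gives back the prefix `q`.
    rw [← List.prefix_iff_eq_take.1 hq] at this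
    simp only [this]
    rw [← hk u]
    exact hgetD _
  induction q using List.reverseRecOn with
  | nil => exact ⟨hrep [] hq n hlen, by simp [programClauses]⟩
  | append_singleton q a ih =>
    obtain ⟨hr, hs⟩ := ih ((List.prefix_append q [a]).trans hq)
    have hr' := hrep _ hq (Instr.outDim (programClauses M n q).2.1 a) fun u => by
      rw [List.foldl_append]
      exact hr.length_step a u
    rw [programClauses_append_singleton, LinCNF.sat_append]
    rw [List.length_append, List.length_singleton, ← programClauses_fst M n q] at hr'
    refine ⟨hr', hs, hr.sat_of_step h1 hadj (hmsg _) ?_⟩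
    rwa [List.foldl_append] at hr'

end run

/-! ### Correctness of the verification algorithm -/

theorem ARP.not_holds_of_sat {P : ARP} {M c : ℕ} (hc : c < M) {x : Var → ℝ} (h1 : x Var.one = 1)
    (h : LinCNF.Sat x (P.clauses M c)) : ¬ P.Holds := by
  simp only [ARP.clauses, LinCNF.sat_append, LinCNF.sat_flatMap] at h
  obtain ⟨⟨⟨hadj, hcons⟩, hprog⟩, hout⟩ := h
  rw [sat_adjClauses h1] at hadj
  -- Edges are the pairs with positive variable; the clause comparing the variables of `(u, w)` and
  -- `(w, u)` makes this symmetric.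
  let G : LabeledGraph P.net.inDim :=
    { V := Fin M
      adj := fun u w => 0 < x (Var.adj u w)
      symm := fun u w h => h.trans_le ((hadj u u.2).2 w w.2).2.2
      label := fun u => (List.range P.net.inDim).map fun i => x (Var.state 0 u i)
      length_label := fun u => by simp }
  let e : G.V ≃ Fin M := Equiv.refl _
  have hG : RepresentsAdj e x := fun u w =>
    ⟨fun h => ((hadj u u.2).2 w w.2).1.resolve_left (not_le.2 h), fun h => not_lt.1 h⟩
  have hX : Represents e x 0 P.net.inDim G.label := fun u => rfl
  have hrun := hX.program_of_sat h1 hG hprog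
  intro hP
  have hY := hP G ⟨c, hc⟩ ⟨Finset.sup_le fun u _ => ?_, fun q hq u hu => ?_⟩
  · rw [MPNN.eval_eq_foldl_program, hrun] at hY
    exact sat_outputClauses.1 hout hY
  · have hd := (hadj u u.2).1
    rw [sum_range_eq_sum_node e] at hd
    -- Edges contribute at least `1` to the row sum and the remaining pairs at least `0`.
    have hle : ((G.neigh u).card : ℝ) ≤ ∑ w : G.V, x (Var.adj (e u) (e w)) := by
      rw [Finset.card_eq_sum_ones, Nat.cast_sum]
      calc ∑ w ∈ G.neigh u, ((1 : ℕ) : ℝ) ≤ ∑ w ∈ G.neigh u, x (Var.adj (e u) (e w)) :=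
            Finset.sum_le_sum fun w hw => by
              simpa using (hG u w).1 (LabeledGraph.mem_neigh.1 hw)
        _ ≤ _ := Finset.sum_le_sum_of_subset_of_nonneg (Finset.subset_univ _)
            fun w _ _ => ((hadj u u.2).2 w w.2).2.1
    exact_mod_cast hle.trans hd
  · obtain ⟨hnear, hlab⟩ := hcons q hq
    rw [sat_nearClauses h1] at hnear
    -- Marks start at the centre and spread with the radius, either staying at a node or following
    -- an edge.
    have hball : ∀ r ≤ q.1, ∀ w : Fin M, w ∈ G.ball ⟨c, hc⟩ r → 1 ≤ x (Var.near r w) := by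
      intro r
      induction r with
      | zero =>
        intro _ w hw
        rw [Set.mem_singleton_iff.1 hw]
        exact hnear.1
      | succ r ih =>
        intro hr w hw
        rcases hw with hw | ⟨z, hz, hzw⟩
        · have hw := ih (by omega) w hw
          exact (hnear.2 r (by omega) w w.2).1.resolve_left (not_le.2 (by linarith))
        · have hz := ih (by omega) z hz
          exact (((hnear.2 r (by omega) z z.2).2 w w.2).resolve_left
            (not_le.2 (by linarith))).resolve_left (not_le.2 hzw)
    exact ((sat_labelClauses h1).1 hlab u u.2).resolve_left
      (not_le.2 (by linarith [hball q.1 le_rfl u hu]))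

open Classical in
/-- The assignment that describes the run of a program on a graph whose nodes are numbered. -/
noncomputable def runAssignment {n : ℕ} (G : LabeledGraph n) (v : G.V) (g : ℕ → G.V)
    (p : List Instr) : Var → ℝ
  | (0, _, _, _, _) => 1
  | (1, u, w, _, _) => if G.adj (g u) (g w) then 1 else 0
  | (2, r, u, _, _) => if g u ∈ G.ball v r then 1 else 0
  | (3, t, u, i, _) => ((p.take t).foldl (Instr.step G) G.label (g u)).getD i 0
  | (_, t, u, w, i) => if G.adj (g u) (g w) then
      ((p.take t).foldl (Instr.step G) G.label (g w)).getD i 0 else 0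

theorem ARP.exists_sat {P : ARP} {G : LabeledGraph P.net.inDim} {v : G.V} {M : ℕ}
    (e : G.V ≃ Fin M) (hin : P.input.Sat G v) (hout : ¬ P.output.Sat (P.net.eval G v)) :
    ∃ x : Var → ℝ, x Var.one = 1 ∧ LinCNF.Sat x (P.clauses M (e v)) := by
  classical
  -- Numbers from `M` on get the dummy node `v`; the clauses speak only of numbers below `M`.
  let g : ℕ → G.V := fun k => if h : k < M then e.symm ⟨k, h⟩ else v
  have hg : ∀ u, g (e u) = u := fun u => by simp [g]
  set x := runAssignment G v g P.net.program with hx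
  have h1 : x Var.one = 1 := rfl
  have hadj : ∀ u w : G.V, x (Var.adj (e u) (e w)) = if G.adj u w then 1 else 0 := fun u w => by
    simp only [hx, Var.adj, runAssignment, hg]
  have hnear : ∀ r (u : G.V), x (Var.near r (e u)) = if u ∈ G.ball v r then 1 else 0 :=
    fun r u => by simp only [hx, Var.near, runAssignment, hg]
  have hstate : ∀ t (u : G.V) i, x (Var.state t (e u) i) =
      ((P.net.program.take t).foldl (Instr.step G) G.label u).getD i 0 := fun t u i => by
    simp only [hx, Var.state, runAssignment, hg]
  have hmsg : ∀ t (u w : G.V) i, x (Var.msg t (e u) (e w) i) =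
      if G.adj u w then x (Var.state t (e w) i) else 0 := fun t u w i => by
    simp only [hx, Var.msg, Var.state, runAssignment, hg]
  have hG : RepresentsAdj e x := fun u w =>
    ⟨fun h => by simp [hadj, h], fun h => by simp [hadj, h]⟩
  have hrun := fun q hq => Represents.sat_program (e := e) h1 hG
    (fun t u w i => ⟨fun h => by simp [hmsg, h], fun h => by simp [hmsg, h]⟩)
    G.length_label hstate q hq
  refine ⟨x, h1, ?_⟩
  simp only [ARP.clauses, LinCNF.sat_append, LinCNF.sat_flatMap]
  refine ⟨⟨⟨?_, fun q hq => ⟨?_, ?_⟩⟩, (hrun _ List.prefix_rfl).2⟩, ?_⟩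
  · refine (sat_adjClauses h1).2 ((forall_lt_iff_forall_node e).2 fun u =>
      ⟨?_, (forall_lt_iff_forall_node e).2 fun w => ?_⟩)
    · rw [sum_range_eq_sum_node e]
      have : ∑ w, x (Var.adj (e u) (e w)) = (G.neigh u).card := by
        simp only [hadj, Finset.sum_boole, LabeledGraph.neigh]
      rw [this]
      exact_mod_cast (G.card_neigh_le_degree u).trans hin.1
    · rw [hadj, hadj]
      by_cases h : G.adj u w
      · simp [h, G.symm u w h]
      · simp [h, mt (G.symm w u) h]
  · refine (sat_nearClauses h1).2 ⟨?_, fun s _ => (forall_lt_iff_forall_node e).2 fun u =>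
      ⟨?_, (forall_lt_iff_forall_node e).2 fun w => ?_⟩⟩
    · simp [hnear, G.center_mem_ball v 0]
    · by_cases hu : u ∈ G.ball v s
      · simp [hnear, G.ball_subset_ball_succ v s hu]
      · simp [hnear, hu]
    · by_cases hu : u ∈ G.ball v s
      · by_cases hw : G.adj u w
        · simp [hnear, LabeledGraph.mem_ball_succ_of_adj hu hw]
        · simp [hadj, hw]
      · simp [hnear, hu]
  · refine (sat_labelClauses h1).2 ((forall_lt_iff_forall_node e).2 fun u => ?_)
    by_cases hu : u ∈ G.ball v q.1
    · refine Or.inr ?_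
      have h0 : G.label u = (List.range P.net.inDim).map fun i => x (Var.state 0 (e u) i) :=
        (hrun [] List.nil_prefix).1 u
      rw [← h0]
      exact hin.2 q hq u hu
    · simp [hnear, hu]
  · rw [sat_outputClauses, ← (hrun _ List.prefix_rfl).1 v, ← MPNN.eval_eq_foldl_program]
    exact hout

theorem ARP.verify_iff (P : ARP) : P.verify = true ↔ P.Holds := by
  have h : P.verify = false ↔ ∃ M < (P.input.degBound + 1) ^ P.net.layers.length + 1,
      ∃ c < M, ∃ x : Var → ℝ, x Var.one = 1 ∧ LinCNF.Sat x (P.clauses M c) := by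
    simp only [ARP.verify, Bool.not_eq_false', List.any_eq_true, List.mem_range,
      LinCNF.satisfiable_iff]
  rw [← not_iff_not, Bool.not_eq_true, h]
  constructor
  · rintro ⟨M, -, c, hc, x, h1, hx⟩
    exact ARP.not_holds_of_sat hc h1 hx
  · intro hP
    obtain ⟨G, v, hcard, hin, hout⟩ := ARP.exists_small_counterexample hP
    let e := Fintype.equivFin G.V
    exact ⟨_, Nat.lt_succ_of_le hcard, e v, (e v).2, ARP.exists_sat e hin hout⟩

end MPNNVerif

theorem corollary2 :
    MPNNVerif.FormallyVerifiable MPNNVerif.ARP.Holds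
      (MPNNVerif.ARPnode MPNNVerif.PhiBound MPNNVerif.PsiClass) :=
  ⟨MPNNVerif.ARP.verify, MPNNVerif.ARP.primrec_verify.to_comp,
    fun P _ => ⟨P.verify_iff.2, P.verify_iff.1⟩⟩
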